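/- Let $m\in\{0,1,2,\dots\}$, $\nu=-m-\tfrac12$, let $\alpha<1$ and $b>0$ be real, and put $c=\frac1{1-\alpha}>0$ and $z=\frac{(1-\alpha)b^2}{4}>0$. Write $(a)_r=a(a+1)\cdots(a+r-1)$, $(a)_0=1$, $\psi=\Gamma'/\Gamma$, and ${}_1F_2(a;b_1,b_2;x)=\sum_{r\ge0}\frac{(a)_r}{(b_1)_r(b_2)_r}\frac{x^r}{r!}$; $1/\Gamma$ is taken to be $0$ at the poles of $\Gamma$. Then the cut-off integral $$I_{2\alpha}^{(d)}=\int_0^{d}x^{\nu}\,[1-(1-\alpha)x]^{\frac1{1-\alpha}}\,e^{-bx^{-1/2}}\,dx,\qquad d=\frac1{1-\alpha},$$ and both infinite series below converge (absolutely), and $$ \begin{aligned} I_{2\alpha}^{(d)}=\frac{\Gamma(c+1)}{\sqrt\pi\,(1-\alpha)^{\nu+1}}\Bigg\{&\frac{\sqrt\pi\,\Gamma(\frac12-m)}{\Gamma(\frac32-m+c)}\;{}_1F_2\!\left(m-\tfrac12-c;\ \tfrac12,\ \tfrac12+m;\ z\right)\\ &+\frac{\Gamma(m-\frac12)\,\Gamma(m)}{\Gamma(1+c)}\,z^{\frac12-m}\sum_{r=0}^{m-1}\frac1{r!}\,\frac{(-c)_r}{(\frac32-m)_r\,(1-m)_r}\,z^r\\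 &-2\sqrt\pi\sum_{r=0}^{\infty}z^{\frac12+r}\,\bigl[-\ln z+G'_r\bigr]H'_r\Bigg\}, \end{aligned} $$ where the second part is absent (equal to $0$) for $m=0$, and $$G'_r=\psi(-\tfrac12-r)-\psi(1+c-m-r)+\psi(1+r)+\psi(1+m+r),\qquad H'_r=\frac{(-1)^m\,(m-c)_r}{(\frac32)_r\,r!\,(m+r)!\,\Gamma(1+c-m)}.$$ If $c=N$ is an integer and $r\ge N+1-m$, so that $G'_r$ has a pole and $H'_r$ a zero at this $\alpha$, the product $[-\ln z+G'_r]H'_r$ stands for its value in the limit, $\dfrac{(-1)^{N+1}(m+r-1-N)!}{(\frac32)_r\,r!\,(m+r)!}$. For every $\alpha<1$ and every $r$, the coefficient $[-\ln z+G'_r]H'_r$ so read is the limit, as $\beta\to\alpha$ with $\beta\neq\alpha$, of the same expression formed with $\beta$ in place of $\alpha$. -/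

import Mathlib

open Filter Topology

noncomputable section

namespace ThermoCutoff

/-- The psi function `ψ = Γ'/Γ` on the real line. -/
def psi (x : ℝ) : ℝ := logDeriv Real.Gamma x

/-- The Pochhammer symbol `(a)_r = a (a+1) ⋯ (a+r-1)`, `(a)_0 = 1`. -/
def poch (a : ℝ) (r : ℕ) : ℝ := (ascPochhammer ℝ r).eval a

/-- The `r`-th term of the generalized hypergeometric series `₁F₂(a; b₁, b₂; x)`. -/
def hyp1F2Term (a b₁ b₂ x : ℝ) (r : ℕ) : ℝ :=
  poch a r / (poch b₁ r * poch b₂ r) * (x ^ r / (r.factorial : ℝ))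

/-- The generalized hypergeometric function `₁F₂(a; b₁, b₂; x)`. -/
def hyp1F2 (a b₁ b₂ x : ℝ) : ℝ := ∑' r : ℕ, hyp1F2Term a b₁ b₂ x r

/-- The integrand `x^ν [1 - (1-α) x]^{1/(1-α)} exp (-b x^{-1/2})`. -/
def integrand (α b ν x : ℝ) : ℝ :=
  x ^ ν * (1 - (1 - α) * x) ^ (1 / (1 - α)) * Real.exp (-b * x ^ (-(1 / 2) : ℝ))

/-- The cut-off integral `I_{2α}^{(d)}` with `d = 1/(1-α)`. -/
def I2 (α b ν : ℝ) : ℝ := ∫ x in (0 : ℝ)..(1 / (1 - α)), integrand α b ν x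

/-- The argument `(1-α) b² / 4` of all the series. -/
def zArg (α b : ℝ) : ℝ := (1 - α) * b ^ 2 / 4

/-- `G'_r = ψ(-1/2-r) - ψ(1+1/(1-α)-m-r) + ψ(1+r) + ψ(1+m+r)`. -/
def coeffG (m : ℕ) (α : ℝ) (r : ℕ) : ℝ :=
  psi (-(1 / 2) - r) - psi (1 + 1 / (1 - α) - m - r) + psi (1 + r) + psi (1 + m + r)

/-- `H'_r = (-1)^m (m - 1/(1-α))_r / ((3/2)_r r! (m+r)! Γ(1+1/(1-α)-m))`, where `1/Γ` is `0` at
the poles of `Γ` (in Mathlib `Γ` has the value `0` there and `x / 0 = 0`). -/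
def coeffH (m : ℕ) (α : ℝ) (r : ℕ) : ℝ :=
  (-1) ^ m * poch (m - 1 / (1 - α)) r /
    (poch (3 / 2) r * (r.factorial : ℝ) * ((m + r).factorial : ℝ) *
      Real.Gamma (1 + 1 / (1 - α) - m))

/-- The product `[-ln z + G'_r] H'_r` evaluated literally, `z = (1-α) b² / 4`. -/
def rawLogCoeff (m : ℕ) (b : ℝ) (r : ℕ) (α : ℝ) : ℝ :=
  (-Real.log (zArg α b) + coeffG m α r) * coeffH m α r

open Classical in
/-- The coefficient `[-ln z + G'_r] H'_r`. If `1+1/(1-α)-m-r` is a pole of `ψ`, that is, if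
`1/(1-α) = N` is an integer with `N < m + r`, then `G'_r` has a pole and `H'_r` a zero at `α`,
and the product is given the value `(-1)^(N+1) (m+r-1-N)! / ((3/2)_r r! (m+r)!)`, its limit. -/
def logCoeff (m : ℕ) (b : ℝ) (r : ℕ) (α : ℝ) : ℝ :=
  if ∃ n : ℕ, 1 + 1 / (1 - α) - m - r = -(n : ℝ) then
    (-1) ^ (⌊1 / (1 - α)⌋₊ + 1) * ((m + r - 1 - ⌊1 / (1 - α)⌋₊).factorial : ℝ) /
      (poch (3 / 2) r * (r.factorial : ℝ) * ((m + r).factorial : ℝ))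
  else rawLogCoeff m b r α

end ThermoCutoff

end

noncomputable section

namespace ThermoCutoff

open MeasureTheory Set

/-! Put c = 1/(1-α) and s = b√(1-α), so z = s²/4. The substitution u = (1-α)x reduces the integral
to ∫₀¹ (1-u)^c u^(-m-1/2) exp(-s u^(-1/2)) du. Since c > 0, the binomial coefficients of (1-u)^c are
absolutely summable, so termwise integration is allowed; with u = t^(-2) the j-th integral is twice
the exponential integral `expInt` at the integer 2m-1-2j.

Each `expInt` is a closed term minus the entire series `expSum`, from which the term with zero
denominator is deleted. The closed term is a power of 1/s for j < m (the finite sum) and carries -ln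
s + ψ for j ≥ m. The deleted series form an absolutely convergent double series with integer
denominators. Summing it over j first leaves `betaSeries`: even powers of s meet it at
half-integers, where it is a beta function (the ₁F₂ part); odd powers meet it at -(m+r), where it is
the finite part of that beta function at a pole and joins the logarithms.

Writing everything with 1/Γ and its derivative, both entire, makes integer c an ordinary case and
gives the limit statement by continuity. The main lemmas are `expInt_neg_natCast`,
`betaSeries_neg_nat`, `setIntegral_expansion` and `logTerm_eq`. -/

lemma poch_zero (a : ℝ) : poch a 0 = 1 := by simp [poch]

lemma poch_succ (a : ℝ) (r : ℕ) : poch a (r + 1) = poch a r * (a + r) := by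
  simp [poch, ascPochhammer_succ_eval]

lemma hasSum_congr {ι : Type*} {f g : ι → ℝ} {x y : ℝ} (h : HasSum f x) (hfg : ∀ i, g i = f i)
    (hxy : y = x) : HasSum g y := by
  rw [hxy, funext hfg]; exact h

/-! ### Binomial series and termwise integration -/

/-- The coefficients `(-c)_j / j!` of the binomial series of `(1 - u) ^ c`. -/
def binCoeff (c : ℝ) (j : ℕ) : ℝ := poch (-c) j / (j.factorial : ℝ)

lemma binCoeff_zero (c : ℝ) : binCoeff c 0 = 1 := by simp [binCoeff, poch_zero]

lemma binCoeff_succ (c : ℝ) (j : ℕ) :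
    ((j : ℝ) + 1) * binCoeff c (j + 1) = (j - c) * binCoeff c j := by
  have h : ((j.factorial : ℕ) : ℝ) ≠ 0 := by positivity
  rw [binCoeff, binCoeff, poch_succ, Nat.factorial_succ]
  push_cast
  field_simp
  ring

lemma hasSum_binCoeff_mul_pow (c : ℝ) {u : ℝ} (hu : |u| < 1) :
    HasSum (fun j => binCoeff c j * u ^ j) ((1 - u) ^ c) := by
  have h := (Real.one_div_one_sub_rpow_hasFPowerSeriesOnBall_zero (-c)).hasSum (y := u)
    (by simpa [enorm_eq_nnnorm, ← NNReal.coe_lt_one] using hu)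
  have h1 : 0 < 1 - u := by linarith [le_abs_self u]
  refine hasSum_congr h (fun j => ?_) ?_
  · have hj : ((j.factorial : ℕ) : ℝ) ≠ 0 := by positivity
    have := Ring.factorial_nsmul_multichoose_eq_ascPochhammer (-c) j
    rw [Polynomial.ascPochhammer_smeval_eq_eval, nsmul_eq_mul] at this
    simp only [FormalMultilinearSeries.ofScalars_apply_eq, Ring.choose, smul_eq_mul]
    -- `Ring.choose r j` unfolds to the multichoose of r-j+1, which is -c for r = -c+j-1.
    rw [show -c + (j : ℝ) - 1 - j + 1 = -c by ring, binCoeff, poch, ← this]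
    field_simp
  · rw [zero_add, Real.rpow_neg h1.le, one_div, inv_inv]

/-- For j ≥ N > c the recurrence, in absolute values, reads c|a_j| = j|a_j| - (j+1)|a_{j+1}|. The
sum telescopes and its partial sums stay below N|a_N|. -/
lemma summable_abs_binCoeff {c : ℝ} (hc : 0 < c) : Summable fun j => |binCoeff c j| := by
  obtain ⟨N, hN⟩ := exists_nat_gt c
  rw [← summable_nat_add_iff N]
  have key : ∀ j : ℕ, c * |binCoeff c (j + N)| =
      ((j + N : ℕ) : ℝ) * |binCoeff c (j + N)|
        - ((j + 1 + N : ℕ) : ℝ) * |binCoeff c (j + 1 + N)| := by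
    intro j
    have h := congrArg abs (binCoeff_succ c (j + N))
    have h0 : (0 : ℝ) ≤ ((j + N : ℕ) : ℝ) - c := by push_cast; linarith [(j.cast_nonneg : (0:ℝ) ≤ j)]
    rw [abs_mul, abs_mul, abs_of_nonneg h0,
      abs_of_nonneg (by positivity : (0 : ℝ) ≤ ((j + N : ℕ) : ℝ) + 1)] at h
    rw [show j + 1 + N = j + N + 1 by ring]
    push_cast at h ⊢
    linarith
  have hs : Summable fun j : ℕ => c * |binCoeff c (j + N)| := by
    refine summable_of_sum_range_le (c := (N : ℝ) * |binCoeff c N|) (fun j => by positivity)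
      fun n => ?_
    have hsum := Finset.sum_range_sub' (fun j : ℕ => ((j + N : ℕ) : ℝ) * |binCoeff c (j + N)|) n
    rw [Finset.sum_congr rfl fun j _ => key j, hsum]
    have : 0 ≤ ((n + N : ℕ) : ℝ) * |binCoeff c (n + N)| := by positivity
    simp only [Nat.zero_add]
    linarith
  exact (summable_mul_left_iff hc.ne').1 hs

lemma summable_binCoeff {c : ℝ} (hc : 0 < c) : Summable (binCoeff c) :=
  (summable_abs_binCoeff hc).of_abs

lemma hasSum_integral_one_sub_rpow_mul {c : ℝ} (hc : 0 < c) {g : ℝ → ℝ}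
    (hg : IntegrableOn g (Ioo 0 1)) :
    HasSum (fun j => binCoeff c j * ∫ u in Ioo (0 : ℝ) 1, u ^ j * g u)
      (∫ u in Ioo (0 : ℝ) 1, (1 - u) ^ c * g u) := by
  have hle : ∀ j : ℕ, ∀ᵐ u ∂volume.restrict (Ioo (0 : ℝ) 1), ‖(u : ℝ) ^ j‖ ≤ 1 := fun j =>
    (ae_restrict_iff' measurableSet_Ioo).2 <| .of_forall fun u hu => by
      rw [norm_pow, Real.norm_of_nonneg hu.1.le]
      exact pow_le_one₀ hu.1.le hu.2.le
  have hint : ∀ j : ℕ, IntegrableOn (fun u : ℝ => u ^ j * g u) (Ioo 0 1) := fun j =>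
    Integrable.bdd_mul (c := 1) hg (by fun_prop) (hle j)
  have h := hasSum_integral_of_summable_integral_norm (μ := volume.restrict (Ioo (0 : ℝ) 1))
    (F := fun j u => binCoeff c j * (u ^ j * g u)) (fun j => (hint j).const_mul _) ?_
  · refine hasSum_congr h (fun j => by rw [integral_const_mul]) ?_
    · refine setIntegral_congr_fun measurableSet_Ioo fun u hu => ?_
      have := (hasSum_binCoeff_mul_pow c (u := u)
        (by rw [abs_of_pos hu.1]; exact hu.2)).mul_right (g u)
      simp only [← mul_assoc]
      exact this.tsum_eq.symm
  · refine Summable.of_nonneg_of_le (fun j => integral_nonneg fun u => norm_nonneg _) (fun j => ?_)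
      ((summable_abs_binCoeff hc).mul_right (∫ u in Ioo (0 : ℝ) 1, ‖g u‖))
    rw [← integral_const_mul]
    refine integral_mono_ae ((hint j).const_mul _).norm (hg.norm.const_mul _) ?_
    filter_upwards [hle j] with u hu
    rw [norm_mul, norm_mul, Real.norm_eq_abs (binCoeff c j)]
    have : ‖(u : ℝ) ^ j‖ * ‖g u‖ ≤ 1 * ‖g u‖ := by gcongr
    rw [one_mul] at this
    gcongr

/-! ### The series `betaSeries`: beta integral and recurrences -/

/-- The series `∑ (-c)_j / (j! (j + x))`; a term with `j + x = 0` counts as zero. -/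
def betaSeries (c x : ℝ) : ℝ := ∑' j : ℕ, binCoeff c j * ((j : ℝ) + x)⁻¹

lemma integral_pow_mul_rpow {x : ℝ} (hx : 0 < x) (j : ℕ) :
    ∫ u in Ioo (0 : ℝ) 1, u ^ j * u ^ (x - 1) = ((j : ℝ) + x)⁻¹ := by
  have h : ∫ u in Ioo (0 : ℝ) 1, u ^ j * u ^ (x - 1) = ∫ u in Ioo (0 : ℝ) 1, u ^ ((j : ℝ) + x - 1) := by
    refine setIntegral_congr_fun measurableSet_Ioo fun u hu => ?_
    rw [← Real.rpow_natCast, ← Real.rpow_add hu.1]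
    ring_nf
  have hj : (0 : ℝ) < j + x := by positivity
  rw [h, ← integral_Ioc_eq_integral_Ioo, ← intervalIntegral.integral_of_le zero_le_one,
    integral_rpow (Or.inl (by linarith)), sub_add_cancel, Real.one_rpow, Real.zero_rpow hj.ne']
  simp

lemma integral_rpow_mul_one_sub_rpow {x c : ℝ} (hx : 0 < x) (hc : 0 < c) :
    ∫ u in Ioo (0 : ℝ) 1, (1 - u) ^ c * u ^ (x - 1) =
      Real.Gamma x * Real.Gamma (c + 1) / Real.Gamma (x + (c + 1)) := by
  have h := ProbabilityTheory.beta_eq_betaIntegralReal x (c + 1) hx (by linarith)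
  rw [ProbabilityTheory.beta] at h
  rw [h, Complex.betaIntegral, intervalIntegral.integral_of_le zero_le_one,
    integral_Ioc_eq_integral_Ioo,
    ← Complex.ofReal_re (∫ u in Ioo (0 : ℝ) 1, (1 - u) ^ c * u ^ (x - 1)), ← integral_complex_ofReal]
  congr 1
  refine setIntegral_congr_fun measurableSet_Ioo fun u hu => ?_
  have h1 : 0 ≤ 1 - u := by linarith [hu.2]
  push_cast
  rw [Complex.ofReal_cpow h1, Complex.ofReal_cpow hu.1.le]
  push_cast
  ring_nf

lemma betaSeries_of_pos {x c : ℝ} (hx : 0 < x) (hc : 0 < c) :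
    betaSeries c x = Real.Gamma x * Real.Gamma (c + 1) / Real.Gamma (x + (c + 1)) := by
  have hg : IntegrableOn (fun u : ℝ => u ^ (x - 1)) (Ioo 0 1) :=
    ((intervalIntegrable_iff_integrableOn_Ioc_of_le zero_le_one).1
      (intervalIntegral.intervalIntegrable_rpow' (by linarith))).mono_set Ioo_subset_Ioc_self
  have h := hasSum_integral_one_sub_rpow_mul hc hg
  rw [integral_rpow_mul_one_sub_rpow hx hc] at h
  simp only [integral_pow_mul_rpow hx] at h
  exact HasSum.tsum_eq h

lemma summable_binCoeff_mul_inv {c : ℝ} (hc : 0 < c) (x : ℝ) :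
    Summable fun j : ℕ => binCoeff c j * ((j : ℝ) + x)⁻¹ := by
  obtain ⟨N, hN⟩ := exists_nat_gt (1 - x)
  rw [← summable_nat_add_iff N]
  refine Summable.of_norm_bounded ((summable_nat_add_iff N).2 (summable_abs_binCoeff hc))
    fun j => ?_
  have : (1 : ℝ) ≤ ((j + N : ℕ) : ℝ) + x := by
    push_cast; linarith [(j.cast_nonneg : (0:ℝ) ≤ j)]
  rw [norm_mul, Real.norm_eq_abs, norm_inv, Real.norm_of_nonneg (by linarith)]
  exact mul_le_of_le_one_right (abs_nonneg _) (inv_le_one_of_one_le₀ this)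

/-- The sum of j a_j/(j+x) is evaluated twice: by j/(j+x) = 1 - x/(j+x), and after the shift j → j+1
by (j+1)a_{j+1} = (j-c)a_j. The shift loses nothing, as the term j = 0 vanishes. -/
lemma mul_betaSeries {c x : ℝ} (hc : 0 < c) (hx : ∀ n : ℕ, x ≠ -n) :
    x * betaSeries c x = (c + 1 + x) * betaSeries c (x + 1) := by
  have e1 : HasSum (fun j : ℕ => (j : ℝ) * binCoeff c j * ((j : ℝ) + x)⁻¹)
      ((∑' j, binCoeff c j) - x * betaSeries c x) := by
    refine hasSum_congr ((summable_binCoeff hc).hasSum.sub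
      ((summable_binCoeff_mul_inv hc x).hasSum.mul_left x)) (fun j => ?_) rfl
    have : (j : ℝ) + x ≠ 0 := fun h => hx j (by linarith)
    field_simp
    ring
  have e2 : HasSum (fun j : ℕ => (((j + 1 : ℕ) : ℝ)) * binCoeff c (j + 1) * (((j + 1 : ℕ) : ℝ) + x)⁻¹)
      ((∑' j, binCoeff c j) - (c + 1 + x) * betaSeries c (x + 1)) := by
    refine hasSum_congr ((summable_binCoeff hc).hasSum.sub
      ((summable_binCoeff_mul_inv hc (x + 1)).hasSum.mul_left (c + 1 + x))) (fun j => ?_) rfl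
    have : (j : ℝ) + 1 + x ≠ 0 := fun h => hx (j + 1) (by push_cast; linarith)
    have h2 : (j : ℝ) + (x + 1) ≠ 0 := by rwa [show (j : ℝ) + (x + 1) = j + 1 + x by ring]
    push_cast
    rw [binCoeff_succ]
    field_simp
    ring
  have e3 := (hasSum_nat_add_iff' 1).2 e1
  simp only [Finset.range_one, Finset.sum_singleton, Nat.cast_zero, zero_mul, sub_zero] at e3
  linarith [e3.unique e2]

/-- The two evaluations behind `mul_betaSeries`, now at a pole: the resonant term is zero by
convention, so each evaluation needs a one-term correction. -/
lemma betaSeries_neg_succ {c : ℝ} (hc : 0 < c) (p : ℕ) :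
    -((p : ℝ) + 1) * betaSeries c (-((p : ℝ) + 1)) + binCoeff c (p + 1) =
      (c - p) * betaSeries c (-(p : ℝ)) + binCoeff c p := by
  have e1 : HasSum (fun j : ℕ => (j : ℝ) * binCoeff c j * ((j : ℝ) + -((p : ℝ) + 1))⁻¹)
      ((∑' j, binCoeff c j) - (-((p : ℝ) + 1)) * betaSeries c (-((p : ℝ) + 1)) -
        binCoeff c (p + 1)) := by
    refine hasSum_congr (((summable_binCoeff hc).hasSum.sub
      ((summable_binCoeff_mul_inv hc (-((p : ℝ) + 1))).hasSum.mul_left (-((p : ℝ) + 1)))).sub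
      (hasSum_ite_eq (p + 1) (binCoeff c (p + 1)))) (fun j => ?_) rfl
    by_cases hj : j = p + 1
    · subst hj; simp
    · have : (j : ℝ) + -((p : ℝ) + 1) ≠ 0 := fun h => hj (by
        exact_mod_cast (by linarith : (j : ℝ) = p + 1))
      rw [if_neg hj]
      field_simp
      ring
  have e2 : HasSum (fun j : ℕ => (((j + 1 : ℕ) : ℝ)) * binCoeff c (j + 1) *
        (((j + 1 : ℕ) : ℝ) + -((p : ℝ) + 1))⁻¹)
      ((∑' j, binCoeff c j) - (c - p) * betaSeries c (-(p : ℝ)) - binCoeff c p) := by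
    refine hasSum_congr (((summable_binCoeff hc).hasSum.sub
      ((summable_binCoeff_mul_inv hc (-(p : ℝ))).hasSum.mul_left (c - p))).sub
      (hasSum_ite_eq p (binCoeff c p))) (fun j => ?_) rfl
    rw [show ((j + 1 : ℕ) : ℝ) + -((p : ℝ) + 1) = (j : ℝ) + -p by push_cast; ring]
    push_cast
    rw [binCoeff_succ]
    by_cases hj : j = p
    · subst hj; simp
    · have : (j : ℝ) + -(p : ℝ) ≠ 0 := fun h => hj (by
        exact_mod_cast (by linarith : (j : ℝ) = p))
      rw [if_neg hj]
      field_simp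
      ring
  have e3 := (hasSum_nat_add_iff' 1).2 e1
  simp only [Finset.range_one, Finset.sum_singleton, Nat.cast_zero, zero_mul, sub_zero] at e3
  linarith [e3.unique e2]

/-! ### Reciprocal gamma and psi functions -/

/-- The reciprocal gamma function, `0` at the poles of `Γ`. -/
def rGamma (x : ℝ) : ℝ := (Real.Gamma x)⁻¹

lemma rGamma_eq (x : ℝ) : rGamma x = x * rGamma (x + 1) := by
  have h := Complex.one_div_Gamma_eq_self_mul_one_div_Gamma_add_one x
  rw [Complex.Gamma_ofReal, ← Complex.ofReal_one, ← Complex.ofReal_add, Complex.Gamma_ofReal] at h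
  exact_mod_cast h

lemma differentiable_rGamma : Differentiable ℝ rGamma := fun x => by
  have h := (Complex.differentiable_one_div_Gamma x).hasDerivAt.real_of_complex
  have he : rGamma = fun y : ℝ => ((Complex.Gamma y)⁻¹).re := funext fun y => by
    rw [Complex.Gamma_ofReal, ← Complex.ofReal_inv, Complex.ofReal_re, rGamma]
  rw [he]
  exact h.differentiableAt

lemma deriv_rGamma_eq (x : ℝ) : deriv rGamma x = rGamma (x + 1) + x * deriv rGamma (x + 1) := by
  have h : rGamma = fun y => y * rGamma (y + 1) := funext rGamma_eq
  have h1 : HasDerivAt (fun y => rGamma (y + 1)) (deriv rGamma (x + 1)) x :=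
    ((differentiable_rGamma (x + 1)).hasDerivAt).comp_add_const x 1
  have h2 := ((hasDerivAt_id x).mul h1).deriv
  conv_lhs => rw [h]
  simpa [Pi.mul_def] using h2

lemma rGamma_neg_nat (n : ℕ) : rGamma (-(n : ℝ)) = 0 := by
  rw [rGamma, Real.Gamma_neg_nat_eq_zero, inv_zero]

lemma deriv_rGamma_neg_nat (n : ℕ) : deriv rGamma (-(n : ℝ)) = (-1) ^ n * (n.factorial : ℝ) := by
  induction n with
  | zero =>
    rw [deriv_rGamma_eq]
    simp [rGamma]
  | succ n ih =>
    rw [deriv_rGamma_eq, show -((n + 1 : ℕ) : ℝ) + 1 = -n by push_cast; ring, ih, rGamma_neg_nat,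
      Nat.factorial_succ]
    push_cast
    ring

lemma deriv_rGamma {x : ℝ} (hx : ∀ n : ℕ, x ≠ -n) : deriv rGamma x = -psi x * rGamma x := by
  have h0 := Real.Gamma_ne_zero hx
  have h := ((Real.differentiableAt_Gamma hx).hasDerivAt.inv h0).deriv
  change deriv (Real.Gamma)⁻¹ x = _
  rw [h, psi, logDeriv_apply, rGamma]
  field_simp

lemma psi_add_one {x : ℝ} (hx : ∀ n : ℕ, x ≠ -n) : psi (x + 1) = psi x + x⁻¹ := by
  have hx1 : ∀ n : ℕ, x + 1 ≠ -n := fun n h => hx (n + 1) (by push_cast; linarith)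
  have h0 : x ≠ 0 := by simpa using hx 0
  have h1 : rGamma (x + 1) ≠ 0 := inv_ne_zero (Real.Gamma_ne_zero hx1)
  have h := deriv_rGamma_eq x
  rw [deriv_rGamma hx, deriv_rGamma hx1, rGamma_eq x] at h
  field_simp at h ⊢
  linarith

lemma psi_one : psi 1 = -Real.eulerMascheroniConstant := by
  rw [psi, logDeriv_apply, Real.hasDerivAt_Gamma_one.deriv, Real.Gamma_one, div_one]

lemma psi_one_half : psi (1 / 2) = -Real.eulerMascheroniConstant - 2 * Real.log 2 := by
  rw [psi, logDeriv_apply, Real.hasDerivAt_Gamma_one_half.deriv, Real.Gamma_one_half_eq]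
  have : √Real.pi ≠ 0 := by positivity
  field_simp
  ring

lemma ne_neg_nat_of_pos {x : ℝ} (hx : 0 < x) (n : ℕ) : x ≠ -n := by
  have : (0 : ℝ) ≤ n := n.cast_nonneg
  linarith

lemma half_sub_ne_neg_nat (k n : ℕ) : (1 / 2 : ℝ) - k ≠ -n := by
  intro h
  have h2 : (1 : ℝ) + 2 * n = 2 * k := by linarith
  have h3 : 1 + 2 * n = 2 * k := by exact_mod_cast h2
  omega

/-- Both sides grow by 1/(r+1/2) when r grows by one, so no reflection formula is needed. -/
lemma psi_half_sub (r : ℕ) : psi (1 / 2 - r) = psi (1 / 2 + r) := by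
  induction r with
  | zero => simp
  | succ r ih =>
    have h1 := psi_add_one (half_sub_ne_neg_nat (r + 1))
    rw [show (1 / 2 : ℝ) - ((r + 1 : ℕ) : ℝ) + 1 = 1 / 2 - r by push_cast; ring, ih] at h1
    have h2 := psi_add_one (ne_neg_nat_of_pos (by positivity : (0 : ℝ) < 1 / 2 + r))
    rw [show (1 / 2 : ℝ) + ((r + 1 : ℕ) : ℝ) = 1 / 2 + r + 1 by push_cast; ring, h2, h1]
    have : ((1 / 2 : ℝ) - ((r + 1 : ℕ) : ℝ)) = -(1 / 2 + r) := by push_cast; ring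
    rw [this, inv_neg]
    ring

/-- Legendre duplication for ψ, by induction from ψ(1) and ψ(1/2). It trades the ψ(2r+2) produced by
odd powers of s for the two psi values in G'_r; the 2 ln 2 accounts for z = (s/2)². -/
lemma two_mul_psi (r : ℕ) :
    2 * psi (2 * r + 2) = 2 * Real.log 2 + psi (1 + r) + psi (-(1 / 2) - r) := by
  rw [show -(1 / 2 : ℝ) - r = 1 / 2 - ((r + 1 : ℕ) : ℝ) by push_cast; ring, psi_half_sub]
  induction r with
  | zero =>
    have h1 := psi_add_one (ne_neg_nat_of_pos one_pos)
    have h2 := psi_add_one (ne_neg_nat_of_pos (by norm_num : (0 : ℝ) < 1 / 2))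
    norm_num [psi_one, psi_one_half] at h1 h2 ⊢
    rw [h1, h2]
    ring
  | succ r ih =>
    have h1 := psi_add_one (ne_neg_nat_of_pos (by positivity : (0 : ℝ) < 2 * r + 2))
    have h2 := psi_add_one (ne_neg_nat_of_pos (by positivity : (0 : ℝ) < 2 * r + 2 + 1))
    have h3 := psi_add_one (ne_neg_nat_of_pos (by positivity : (0 : ℝ) < 1 + r))
    have h4 := psi_add_one (ne_neg_nat_of_pos
      (by positivity : (0 : ℝ) < 1 / 2 + ((r + 1 : ℕ) : ℝ)))
    rw [show 2 * ((r + 1 : ℕ) : ℝ) + 2 = 2 * r + 2 + 1 + 1 by push_cast; ring, h2, h1,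
      show 1 + ((r + 1 : ℕ) : ℝ) = 1 + r + 1 by push_cast; ring, h3,
      show 1 / 2 + ((r + 1 + 1 : ℕ) : ℝ) = 1 / 2 + ((r + 1 : ℕ) : ℝ) + 1 by push_cast; ring, h4,
      mul_add, mul_add, ih]
    push_cast
    have e1 : (2 * (r : ℝ) + 2) ≠ 0 := by positivity
    have e2 : (2 * (r : ℝ) + 2 + 1) ≠ 0 := by positivity
    have e3 : (1 + (r : ℝ)) ≠ 0 := by positivity
    have e4 : (1 / 2 + ((r : ℝ) + 1)) ≠ 0 := by positivity
    have : 2 * (2 * (r : ℝ) + 2)⁻¹ + 2 * (2 * (r : ℝ) + 2 + 1)⁻¹ =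
        (1 + (r : ℝ))⁻¹ + (1 / 2 + ((r : ℝ) + 1))⁻¹ := by
      field_simp
      ring
    linarith

/-! ### Values of `betaSeries` off and at the poles -/

/-- The beta integral covers x > 0; `mul_betaSeries` continues the formula to the left. With
`rGamma` it also holds where x+c+1 is a pole of Γ. -/
lemma betaSeries_eq {c : ℝ} (hc : 0 < c) {x : ℝ} (hx : ∀ n : ℕ, x ≠ -n) :
    betaSeries c x = Real.Gamma x * Real.Gamma (c + 1) * rGamma (x + (c + 1)) := by
  obtain ⟨N, hN⟩ := exists_nat_gt (-x)
  induction N generalizing x with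
  | zero =>
    rw [betaSeries_of_pos (by simpa using hN) hc, rGamma, div_eq_mul_inv]
  | succ N ih =>
    have hx1 : ∀ n : ℕ, x + 1 ≠ -n := fun n h => hx (n + 1) (by push_cast; linarith)
    have h0 : x ≠ 0 := by simpa using hx 0
    have h := mul_betaSeries hc hx
    rw [ih hx1 (by push_cast at hN; linarith), Real.Gamma_add_one h0] at h
    rw [rGamma_eq (x + (c + 1)), show x + (c + 1) + 1 = x + 1 + (c + 1) by ring]
    apply mul_left_cancel₀ h0
    rw [h]
    ring

lemma binCoeff_eq {c : ℝ} (hc : 0 < c) (p : ℕ) :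
    binCoeff c p = (-1) ^ p / (p.factorial : ℝ) * Real.Gamma (c + 1) * rGamma (c + 1 - p) := by
  induction p with
  | zero =>
    have := Real.Gamma_ne_zero (ne_neg_nat_of_pos (by linarith : 0 < c + 1))
    simp [binCoeff_zero, rGamma, this]
  | succ p ih =>
    have h := binCoeff_succ c p
    rw [ih, show c + 1 - (p : ℝ) = c + 1 - ((p + 1 : ℕ) : ℝ) + 1 by push_cast; ring] at h
    have hp : (p : ℝ) + 1 ≠ 0 := by positivity
    have hf : ((p.factorial : ℕ) : ℝ) ≠ 0 := by positivity
    apply mul_left_cancel₀ hp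
    rw [h, rGamma_eq (c + 1 - ((p + 1 : ℕ) : ℝ)), Nat.factorial_succ]
    push_cast
    field_simp
    ring

/-- Deleting the term j = 0 amounts to the limit of `betaSeries c x` - 1/x as x → 0+. By the beta
formula this difference is the slope at 0 of Γ(x+1)Γ(c+1)/Γ(x+c+1), which equals 1 at 0. -/
lemma betaSeries_zero {c : ℝ} (hc : 0 < c) : betaSeries c 0 = psi 1 - psi (c + 1) := by
  have h1 : Tendsto (fun x => betaSeries c x - x⁻¹) (𝓝[>] 0) (𝓝 (betaSeries c 0)) := by
    have e : ∀ᶠ x in 𝓝[>] (0 : ℝ),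
        ∑' j : ℕ, (if j = 0 then 0 else binCoeff c j * ((j : ℝ) + x)⁻¹) = betaSeries c x - x⁻¹ := by
      filter_upwards with x
      refine ((hasSum_congr ((summable_binCoeff_mul_inv hc x).hasSum.sub
        (hasSum_ite_eq 0 x⁻¹)) (fun j => ?_) rfl)).tsum_eq
      by_cases hj : j = 0
      · subst hj; simp [binCoeff_zero]
      · simp [hj]
    refine Tendsto.congr' e ?_
    have h0 : betaSeries c 0 =
        ∑' j : ℕ, (if j = 0 then 0 else binCoeff c j * ((j : ℝ) + 0)⁻¹) := by
      refine tsum_congr fun j => ?_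
      by_cases hj : j = 0
      · subst hj; simp
      · simp [hj]
    rw [h0]
    -- For j ≥ 1 and x > 0 the factor 1/(j+x) is at most 1, so |a_j| dominates.
    refine tendsto_tsum_of_dominated_convergence (summable_abs_binCoeff hc) (fun j => ?_) ?_
    · by_cases hj : j = 0
      · simp [hj]
      · simp only [if_neg hj]
        refine Tendsto.const_mul _ (Tendsto.inv₀ (Tendsto.const_add _ ?_) ?_)
        · exact tendsto_id.mono_left nhdsWithin_le_nhds
        · simpa using hj
    · filter_upwards [self_mem_nhdsWithin] with x hx j
      by_cases hj : j = 0
      · simp [hj]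
      · rw [if_neg hj, norm_mul, Real.norm_eq_abs]
        have hj1 : (1 : ℝ) ≤ j := by exact_mod_cast Nat.one_le_iff_ne_zero.2 hj
        have hx0 : (0 : ℝ) < x := hx
        refine mul_le_of_le_one_right (abs_nonneg _) ?_
        rw [norm_inv, Real.norm_of_nonneg (by linarith)]
        exact inv_le_one_of_one_le₀ (by linarith)
  have hc1 := ne_neg_nat_of_pos (by linarith : 0 < c + 1)
  have hG := Real.Gamma_ne_zero hc1
  have h2 : Tendsto (fun x => betaSeries c x - x⁻¹) (𝓝[>] 0) (𝓝 (psi 1 - psi (c + 1))) := by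
    let f : ℝ → ℝ := fun x => Real.Gamma (x + 1) * Real.Gamma (c + 1) * rGamma (x + (c + 1))
    have hf : HasDerivAt f (psi 1 - psi (c + 1)) 0 := by
      have d1 : HasDerivAt (fun x : ℝ => Real.Gamma (x + 1)) (-Real.eulerMascheroniConstant) 0 :=
        HasDerivAt.comp_add_const 0 1 (by rw [zero_add]; exact Real.hasDerivAt_Gamma_one)
      have d2 : HasDerivAt (fun x : ℝ => rGamma (x + (c + 1))) (-psi (c + 1) * rGamma (c + 1)) 0 :=
        HasDerivAt.comp_add_const 0 (c + 1) (by
          rw [zero_add, ← deriv_rGamma hc1]; exact (differentiable_rGamma _).hasDerivAt)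
      refine ((d1.mul_const (Real.Gamma (c + 1))).mul d2).congr_deriv ?_
      rw [psi_one, zero_add, zero_add, Real.Gamma_one, rGamma]
      field_simp
      ring
    have hs := (hasDerivAt_iff_tendsto_slope.1 hf).mono_left
      (nhdsWithin_mono (0 : ℝ) fun x (hx : x ∈ Ioi (0 : ℝ)) => (hx : 0 < x).ne')
    refine hs.congr' ?_
    filter_upwards [self_mem_nhdsWithin] with x hx
    have hx0 : (0 : ℝ) < x := hx
    rw [betaSeries_eq hc (ne_neg_nat_of_pos hx0), slope_def_field]
    have hG2 := Real.Gamma_ne_zero (ne_neg_nat_of_pos (by linarith : 0 < x + (c + 1)))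
    have hxn := hx0.ne'
    simp only [f, rGamma, zero_add, Real.Gamma_one, Real.Gamma_add_one hxn, sub_zero]
    field_simp
  exact tendsto_nhds_unique h1 h2

lemma betaSeries_neg_nat {c : ℝ} (hc : 0 < c) (p : ℕ) :
    betaSeries c (-(p : ℝ)) = (-1) ^ p / (p.factorial : ℝ) * Real.Gamma (c + 1) *
      (rGamma (c + 1 - p) * psi (p + 1) + deriv rGamma (c + 1 - p)) := by
  induction p with
  | zero =>
    have hc1 := ne_neg_nat_of_pos (by linarith : 0 < c + 1)
    have hG := Real.Gamma_ne_zero hc1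
    simp only [Nat.cast_zero, neg_zero, sub_zero, zero_add]
    rw [betaSeries_zero hc, deriv_rGamma hc1, rGamma]
    field_simp
    simp
    ring
  | succ p ih =>
    have h := betaSeries_neg_succ hc p
    have hw : c + 1 - (p : ℝ) = c + 1 - ((p + 1 : ℕ) : ℝ) + 1 := by push_cast; ring
    rw [ih, binCoeff_eq hc, binCoeff_eq hc, hw] at h
    have hp : (p : ℝ) + 1 ≠ 0 := by positivity
    have hf : ((p.factorial : ℕ) : ℝ) ≠ 0 := by positivity
    have hψ := psi_add_one (ne_neg_nat_of_pos (by positivity : (0 : ℝ) < p + 1))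
    rw [deriv_rGamma_eq (c + 1 - ((p + 1 : ℕ) : ℝ)), rGamma_eq (c + 1 - ((p + 1 : ℕ) : ℝ))]
    rw [rGamma_eq (c + 1 - ((p + 1 : ℕ) : ℝ)), Nat.factorial_succ] at h
    rw [Nat.factorial_succ]
    push_cast at h ⊢
    rw [hψ]
    apply mul_left_cancel₀ (neg_ne_zero.2 hp)
    rw [eq_sub_of_add_eq h]
    field_simp
    ring

/-! ### Exponential integrals at integers -/

/-- The entire function `∑ (-s)^k / (k! (k + y))`; a term with `k + y = 0` counts as zero. -/
def expSum (s : ℝ) (y : ℤ) : ℝ := ∑' k : ℕ, (-s) ^ k / (k.factorial : ℝ) * ((k : ℝ) + y)⁻¹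

lemma abs_inv_intCast_le_one (n : ℤ) : |((n : ℝ))⁻¹| ≤ 1 := by
  rcases eq_or_ne n 0 with rfl | h
  · simp
  · rw [abs_inv]
    exact inv_le_one_of_one_le₀ (by exact_mod_cast Int.one_le_abs h)

lemma abs_inv_nat_add_int_le_one (k : ℕ) (y : ℤ) : |((k : ℝ) + y)⁻¹| ≤ 1 := by
  exact_mod_cast abs_inv_intCast_le_one (k + y)

lemma summable_expSum (s : ℝ) (y : ℤ) :
    Summable fun k : ℕ => (-s) ^ k / (k.factorial : ℝ) * ((k : ℝ) + y)⁻¹ := by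
  refine Summable.of_norm_bounded (Real.summable_pow_div_factorial |s|) fun k => ?_
  rw [norm_mul, norm_div, norm_pow, norm_neg, Real.norm_natCast, Real.norm_eq_abs, Real.norm_eq_abs]
  exact mul_le_of_le_one_right (by positivity) (abs_inv_nat_add_int_le_one k y)

lemma hasSum_exp_neg (s : ℝ) : HasSum (fun k : ℕ => (-s) ^ k / (k.factorial : ℝ)) (Real.exp (-s)) := by
  rw [Real.exp_eq_exp_ℝ]
  exact NormedSpace.expSeries_div_hasSum_exp (-s)

lemma hasSum_expSum_succ (s : ℝ) (y : ℤ) :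
    HasSum (fun k : ℕ => (k : ℝ) * ((-s) ^ k / (k.factorial : ℝ)) * ((k : ℝ) + y)⁻¹)
      (-s * expSum s (y + 1)) := by
  rw [← hasSum_nat_add_iff' 1]
  simp only [Finset.range_one, Finset.sum_singleton, Nat.cast_zero, zero_mul, sub_zero]
  refine hasSum_congr ((summable_expSum s (y + 1)).hasSum.mul_left (-s)) (fun k => ?_) rfl
  have h : ((k.factorial : ℕ) : ℝ) ≠ 0 := by positivity
  have h1 : (k : ℝ) + 1 ≠ 0 := by positivity
  rw [Nat.factorial_succ]
  push_cast
  rw [show (k : ℝ) + 1 + y = k + (y + 1) by ring]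
  field_simp
  ring

lemma natCast_mul_expSum (s : ℝ) (n : ℕ) :
    ((n : ℝ) + 1) * expSum s (n + 1) = Real.exp (-s) + s * expSum s (n + 2) := by
  have h := hasSum_congr ((hasSum_exp_neg s).sub (hasSum_expSum_succ s (n + 1)))
    (g := fun k : ℕ => ((n : ℝ) + 1) * ((-s) ^ k / (k.factorial : ℝ) * ((k : ℝ) + ((n + 1 : ℤ) : ℝ))⁻¹))
    (fun k => by
      have h2 : (k : ℝ) + (n + 1) ≠ 0 := by positivity
      have h : ((k.factorial : ℕ) : ℝ) ≠ 0 := by positivity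
      push_cast
      field_simp
      ring) rfl
  have h' := ((summable_expSum s (n + 1)).hasSum.mul_left ((n : ℝ) + 1)).unique h
  rw [add_assoc, one_add_one_eq_two] at h'
  rw [expSum, h']
  ring

/-- From -p/(k-p) = 1 - k/(k-p). The identity fails only at the deleted index k = p, whence the
correction (-s)^p/p!. -/
lemma neg_natCast_mul_expSum (s : ℝ) (p : ℕ) :
    -(p : ℝ) * expSum s (-p) =
      Real.exp (-s) - (-s) ^ p / (p.factorial : ℝ) + s * expSum s (-p + 1) := by
  have h := hasSum_congr (((hasSum_exp_neg s).sub (hasSum_expSum_succ s (-p))).sub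
      (hasSum_ite_eq p ((-s) ^ p / (p.factorial : ℝ))))
    (g := fun k : ℕ => -(p : ℝ) * ((-s) ^ k / (k.factorial : ℝ) * ((k : ℝ) + ((-p : ℤ) : ℝ))⁻¹))
    (fun k => by
      by_cases hk : k = p
      · subst hk; simp
      · have h2 : (k : ℝ) - p ≠ 0 := sub_ne_zero.2 (by exact_mod_cast hk)
        have h : ((k.factorial : ℕ) : ℝ) ≠ 0 := by positivity
        rw [if_neg hk]
        push_cast
        rw [← sub_eq_add_neg]
        field_simp
        ring) rfl
  have h' := ((summable_expSum s (-p)).hasSum.mul_left (-(p : ℝ))).unique h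
  rw [expSum, h']
  ring

/-- The generalized exponential integral `∫_1^∞ t^(y-1) exp(-s t) dt`. -/
def expInt (s : ℝ) (y : ℤ) : ℝ := ∫ t in Ioi (1 : ℝ), t ^ (y - 1) * Real.exp (-s * t)

lemma continuousOn_zpow_mul_exp (s : ℝ) (y : ℤ) :
    ContinuousOn (fun t : ℝ => t ^ y * Real.exp (-s * t)) (Ici 1) := by
  refine ContinuousOn.mul (fun t ht => ?_) (by fun_prop)
  exact (continuousAt_zpow₀ t y (Or.inl (by have : (1:ℝ) ≤ t := ht; linarith))).continuousWithinAt

lemma isLittleO_zpow_mul_exp {s : ℝ} (hs : 0 < s) (y : ℤ) :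
    (fun t : ℝ => t ^ y * Real.exp (-s * t)) =o[atTop] fun t => Real.exp (-(s / 2) * t) := by
  have h := (isLittleO_zpow_exp_pos_mul_atTop y (half_pos hs)).mul_isBigO
    (Asymptotics.isBigO_refl (fun t : ℝ => Real.exp (-s * t)) atTop)
  refine h.congr_right fun t => ?_
  rw [← Real.exp_add]
  ring_nf

lemma integrableOn_zpow_mul_exp {s : ℝ} (hs : 0 < s) (y : ℤ) :
    IntegrableOn (fun t : ℝ => t ^ y * Real.exp (-s * t)) (Ioi 1) :=
  integrable_of_isBigO_exp_neg (half_pos hs) (continuousOn_zpow_mul_exp s y)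
    (isLittleO_zpow_mul_exp hs y).isBigO

lemma tendsto_zpow_mul_exp {s : ℝ} (hs : 0 < s) (y : ℤ) :
    Tendsto (fun t : ℝ => t ^ y * Real.exp (-s * t)) atTop (𝓝 0) := by
  refine (isLittleO_zpow_mul_exp hs y).isBigO.trans_tendsto ?_
  refine Real.tendsto_exp_atBot.comp ?_
  exact tendsto_id.const_mul_atTop_of_neg (by linarith)

/-- Integration by parts: the derivative of t^y exp(-st) is integrated over (1,∞). -/
lemma mul_expInt {s : ℝ} (hs : 0 < s) (y : ℤ) :
    (y : ℝ) * expInt s y = s * expInt s (y + 1) - Real.exp (-s) := by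
  have hd : ∀ t ∈ Ici (1 : ℝ), HasDerivAt (fun t : ℝ => t ^ y * Real.exp (-s * t))
      ((y : ℝ) * (t ^ (y - 1) * Real.exp (-s * t)) - s * (t ^ (y + 1 - 1) * Real.exp (-s * t))) t := by
    intro t ht
    have ht0 : t ≠ 0 := by have : (1:ℝ) ≤ t := ht; linarith
    have he : HasDerivAt (fun t : ℝ => Real.exp (-s * t)) (Real.exp (-s * t) * (-s)) t := by
      simpa using ((hasDerivAt_id t).const_mul (-s)).exp
    refine ((hasDerivAt_zpow y t (Or.inl ht0)).mul he).congr_deriv ?_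
    rw [add_sub_cancel_right]
    ring
  have i1 := (integrableOn_zpow_mul_exp hs (y - 1)).const_mul (y : ℝ)
  have i2 := (integrableOn_zpow_mul_exp hs (y + 1 - 1)).const_mul s
  have h := integral_Ioi_of_hasDerivAt_of_tendsto' hd (i1.sub i2) (tendsto_zpow_mul_exp hs y)
  rw [integral_sub i1 i2, integral_const_mul, integral_const_mul] at h
  simp only [expInt]
  rw [one_zpow, one_mul, mul_one] at h
  linarith

lemma hasDerivAt_expSum_zero {x : ℝ} (hx : x ≠ 0) :
    HasDerivAt (fun x => expSum x 0) ((Real.exp (-x) - 1) / x) x := by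
  have h := hasDerivAt_tsum_of_isPreconnected
    (g := fun (k : ℕ) (x : ℝ) => (-x) ^ k / (k.factorial : ℝ) * ((k : ℝ) + ((0 : ℤ) : ℝ))⁻¹)
    (g' := fun (k : ℕ) (x : ℝ) =>
      (k * (-x) ^ (k - 1) * (-1)) / (k.factorial : ℝ) * ((k : ℝ) + ((0 : ℤ) : ℝ))⁻¹)
    (t := Metric.ball 0 (|x| + 1)) (y₀ := x) (y := x)
    (Real.summable_pow_div_factorial (|x| + 1)) Metric.isOpen_ball
    (convex_ball 0 _).isPreconnected
    (fun k y _ => ((((hasDerivAt_id y).neg).pow k).div_const _).mul_const _) ?_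
    (by simp) (summable_expSum x 0) (by simp)
  · refine h.congr_deriv ?_
    rw [eq_div_iff hx, mul_comm, ← tsum_mul_left]
    refine HasSum.tsum_eq (hasSum_congr ((hasSum_exp_neg x).sub (hasSum_ite_eq 0 (1 : ℝ)))
      (fun k => ?_) rfl)
    rcases k with _ | k
    · simp
    · have hk : ((k : ℝ) + 1) ≠ 0 := by positivity
      simp only [Int.cast_zero, add_zero, Nat.add_sub_cancel, if_neg k.succ_ne_zero, sub_zero]
      push_cast
      field_simp
      ring
  · intro k y hy
    rcases k with _ | k
    · simp
    · have hk : ((k : ℝ) + 1) ≠ 0 := by positivity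
      have hy' : |y| ≤ |x| + 1 := by simpa using (Metric.mem_ball.1 hy).le
      have e : (((k + 1 : ℕ) : ℝ) * (-y) ^ (k + 1 - 1) * (-1)) / ((k + 1).factorial : ℝ) *
          (((k + 1 : ℕ) : ℝ) + ((0 : ℤ) : ℝ))⁻¹ = -((-y) ^ k / ((k + 1).factorial : ℝ)) := by
        simp only [Int.cast_zero, add_zero, Nat.add_sub_cancel]
        push_cast
        field_simp
      rw [e, norm_neg, norm_div, norm_pow, norm_neg, Real.norm_natCast, Real.norm_eq_abs]
      gcongr
      calc |y| ^ k ≤ (|x| + 1) ^ k := by gcongr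
        _ ≤ (|x| + 1) ^ (k + 1) := pow_le_pow_right₀ (by linarith [abs_nonneg x]) (by omega)

lemma expSum_zero_zero : expSum 0 0 = 0 := by
  refine (tsum_congr fun k => ?_).trans tsum_zero
  rcases k with _ | k <;> simp

lemma continuousAt_expSum_zero : ContinuousAt (fun x => expSum x 0) 0 := by
  have hc : ContinuousOn (fun x : ℝ => ∑' k : ℕ, (-x) ^ k / (k.factorial : ℝ) *
      ((k : ℝ) + ((0 : ℤ) : ℝ))⁻¹) (Metric.closedBall 0 1) := by
    refine continuousOn_tsum (u := fun k : ℕ => 1 ^ k / (k.factorial : ℝ)) (fun k => by fun_prop)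
      (Real.summable_pow_div_factorial 1) fun k x hx => ?_
    have hx' : |x| ≤ 1 := by simpa using hx
    rw [norm_mul, norm_div, norm_pow, norm_neg, Real.norm_natCast, Real.norm_eq_abs,
      Real.norm_eq_abs]
    calc |x| ^ k / (k.factorial : ℝ) * |((k : ℝ) + ((0 : ℤ) : ℝ))⁻¹|
        ≤ |x| ^ k / (k.factorial : ℝ) :=
          mul_le_of_le_one_right (by positivity) (abs_inv_nat_add_int_le_one k 0)
      _ ≤ 1 ^ k / (k.factorial : ℝ) := by gcongr
  exact hc.continuousAt (Metric.closedBall_mem_nhds 0 one_pos)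

lemma integral_exp_neg_mul_log :
    ∫ t in Ioi (0 : ℝ), Real.exp (-t) * Real.log t = -Real.eulerMascheroniConstant := by
  have h := Complex.hasDerivAt_GammaIntegral (s := 1) (by simp)
  have hG : Complex.GammaIntegral =ᶠ[𝓝 1] Complex.Gamma := by
    have : ∀ᶠ s : ℂ in 𝓝 1, 0 < s.re :=
      (Complex.continuous_re.isOpen_preimage _ isOpen_Ioi).mem_nhds (by simp)
    filter_upwards [this] with s hs
    exact (Complex.Gamma_eq_integral hs).symm
  have h2 := (h.congr_of_eventuallyEq hG.symm).unique Complex.hasDerivAt_Gamma_one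
  have h3 : ∫ t in Ioi (0 : ℝ), ((Real.exp (-t) * Real.log t : ℝ) : ℂ) =
      -(Real.eulerMascheroniConstant : ℂ) := by
    rw [← h2]
    refine setIntegral_congr_fun measurableSet_Ioi fun t ht => ?_
    simp
    ring
  rw [integral_complex_ofReal] at h3
  exact_mod_cast h3

lemma integrableOn_exp_neg_mul_log :
    IntegrableOn (fun t => Real.exp (-t) * Real.log t) (Ioi 0) := by
  -- A non-integrable function would have integral 0 by default, but the value is -γ ≠ 0.
  by_contra hn
  have := integral_exp_neg_mul_log
  rw [integral_undef hn] at this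
  linarith [Real.one_half_lt_eulerMascheroniConstant]

/-- The function f vanishes at 0 and is an antiderivative of e^(-t) ln t, so it tends to -γ; it
differs from ln t + `expSum t 0` by e^(-t) ln t, which tends to 0. -/
lemma tendsto_log_add_expSum :
    Tendsto (fun t => Real.log t + expSum t 0) atTop (𝓝 (-Real.eulerMascheroniConstant)) := by
  let f : ℝ → ℝ := fun t => (1 - Real.exp (-t)) * Real.log t + expSum t 0
  have hd : ∀ t ∈ Ioi (0 : ℝ), HasDerivAt f (Real.exp (-t) * Real.log t) t := by
    intro t ht
    have ht0 : t ≠ 0 := (show 0 < t from ht).ne'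
    have he : HasDerivAt (fun t : ℝ => 1 - Real.exp (-t)) (Real.exp (-t)) t := by
      simpa using (((hasDerivAt_id t).neg).exp).const_sub 1
    refine ((he.mul (Real.hasDerivAt_log ht0)).add (hasDerivAt_expSum_zero ht0)).congr_deriv ?_
    field_simp
    ring
  have hc : ContinuousWithinAt f (Ici 0) 0 := by
    refine ContinuousAt.continuousWithinAt (ContinuousAt.add ?_ continuousAt_expSum_zero)
    have h0 : Tendsto (fun t : ℝ => 2 * |t * Real.log t|) (𝓝 0) (𝓝 0) := by
      have := (Real.continuous_mul_log.abs.const_mul 2).tendsto 0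
      simpa using this
    rw [ContinuousAt, Real.log_zero, mul_zero]
    -- Near 0, |1 - e^(-t)| ≤ 2|t|, and t ln t tends to 0.
    refine squeeze_zero_norm' ?_ h0
    filter_upwards [Metric.closedBall_mem_nhds (0 : ℝ) one_pos] with t ht
    have ht' : |-t| ≤ 1 := by simpa using ht
    have := Real.abs_exp_sub_one_le ht'
    rw [norm_mul, Real.norm_eq_abs, Real.norm_eq_abs, abs_mul, abs_sub_comm, ← mul_assoc]
    rw [abs_neg] at this
    gcongr
  have hi := integrableOn_exp_neg_mul_log
  have ht := tendsto_limUnder_of_hasDerivAt_of_integrableOn_Ioi hd hi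
  have hI := integral_Ioi_of_hasDerivAt_of_tendsto hc hd hi ht
  have f0 : f 0 = 0 := by simp [f, expSum_zero_zero]
  rw [f0, sub_zero, integral_exp_neg_mul_log] at hI
  rw [← hI] at ht
  have hz : Tendsto (fun t : ℝ => Real.exp (-t) * Real.log t) atTop (𝓝 0) := by
    refine squeeze_zero_norm' ?_ (tendsto_zpow_mul_exp one_pos 1)
    filter_upwards [eventually_ge_atTop 1] with t ht
    rw [norm_mul, Real.norm_of_nonneg (Real.exp_pos _).le, Real.norm_of_nonneg (Real.log_nonneg ht),
      zpow_one, mul_comm, neg_one_mul]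
    gcongr
    exact Real.log_le_self (by linarith)
  refine ((ht.add hz).congr fun t => ?_).trans (by rw [add_zero])
  simp only [f]
  ring

lemma expInt_zero {s : ℝ} (hs : 0 < s) : expInt s 0 = -Real.log s + psi 1 - expSum s 0 := by
  have hd : ∀ t ∈ Ici (1 : ℝ), HasDerivAt (fun t : ℝ => Real.log (s * t) + expSum (s * t) 0)
      (t ^ ((0 : ℤ) - 1) * Real.exp (-s * t)) t := by
    intro t ht
    have ht0 : t ≠ 0 := by have : (1:ℝ) ≤ t := ht; linarith
    have hst : s * t ≠ 0 := mul_ne_zero hs.ne' ht0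
    have hl : HasDerivAt (fun t : ℝ => s * t) s t := by
      simpa using (hasDerivAt_id t).const_mul s
    have h1 : HasDerivAt (fun x => Real.log x + expSum x 0)
        ((s * t)⁻¹ + (Real.exp (-(s * t)) - 1) / (s * t)) (s * t) :=
      (Real.hasDerivAt_log hst).add (hasDerivAt_expSum_zero hst)
    refine (h1.comp t hl).congr_deriv ?_
    rw [zero_sub, zpow_neg_one, neg_mul]
    have := hs.ne'
    field_simp
    ring
  have h := integral_Ioi_of_hasDerivAt_of_tendsto' hd (integrableOn_zpow_mul_exp hs _)
    (tendsto_log_add_expSum.comp (tendsto_id.const_mul_atTop hs))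
  rw [expInt, h, psi_one, mul_one]
  ring

lemma expInt_natCast_add_one {s : ℝ} (hs : 0 < s) (n : ℕ) :
    expInt s (n + 1) = (n.factorial : ℝ) / s ^ (n + 1) - expSum s (n + 1) := by
  have hs0 := hs.ne'
  induction n with
  | zero =>
    have h1 := mul_expInt hs 0
    have h2 := neg_natCast_mul_expSum s 0
    simp at h1 h2 ⊢
    field_simp
    linarith
  | succ n ih =>
    have h1 := mul_expInt hs (n + 1)
    have h2 := natCast_mul_expSum s n
    rw [ih] at h1
    rw [add_assoc, one_add_one_eq_two] at h1
    push_cast at h1 ⊢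
    rw [add_assoc, one_add_one_eq_two, Nat.factorial_succ]
    apply mul_left_cancel₀ hs0
    push_cast
    rw [mul_sub, h2] at h1
    have e : s * (((n : ℝ) + 1) * (n.factorial : ℝ) / s ^ (n + 2)) =
        ((n : ℝ) + 1) * ((n.factorial : ℝ) / s ^ (n + 1)) := by
      field_simp
      ring
    rw [mul_sub, show n + 1 + 1 = n + 2 from rfl, e]
    linarith

/-- In the recurrence for `expInt` + `expSum` the exponentials cancel; the correction from the
deleted term is what raises ψ(p+1) to ψ(p+2). -/
lemma expInt_neg_natCast {s : ℝ} (hs : 0 < s) (p : ℕ) :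
    expInt s (-p) = (-s) ^ p / (p.factorial : ℝ) * (-Real.log s + psi (p + 1)) - expSum s (-p) := by
  induction p with
  | zero => simpa using expInt_zero hs
  | succ p ih =>
    have h1 := mul_expInt hs (-(p + 1 : ℕ))
    have h2 := neg_natCast_mul_expSum s (p + 1)
    have e : (-((p + 1 : ℕ) : ℤ) + 1) = -(p : ℤ) := by push_cast; ring
    have hψ := psi_add_one (ne_neg_nat_of_pos (by positivity : (0 : ℝ) < p + 1))
    rw [e] at h1 h2
    rw [ih] at h1
    have hp : -((p + 1 : ℕ) : ℝ) ≠ 0 := by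
      rw [neg_ne_zero]; positivity
    have hf : ((p.factorial : ℕ) : ℝ) ≠ 0 := by positivity
    apply mul_left_cancel₀ hp
    rw [mul_sub, h2]
    rw [Int.cast_neg, Int.cast_natCast] at h1
    rw [h1]
    push_cast
    rw [hψ, Nat.factorial_succ]
    push_cast
    field_simp
    ring

/-! ### The kernel and the substitution u = t^(-2) -/

/-- The kernel `u^(-m-1/2) exp(-s u^(-1/2))`. -/
def kernel (s : ℝ) (m : ℕ) (u : ℝ) : ℝ :=
  u ^ (-(m : ℝ) - 1 / 2) * Real.exp (-s * u ^ (-(1 / 2) : ℝ))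

lemma rpow_neg_two_mem_Ioo {x : ℝ} (hx : 0 < x) : x ^ (-2 : ℝ) ∈ Ioo (0 : ℝ) 1 ↔ x ∈ Ioi (1 : ℝ) := by
  constructor
  · intro h
    by_contra hx1
    have hle : x ≤ 1 := not_lt.1 hx1
    exact absurd h.2 (not_lt.2 (Real.one_le_rpow_of_pos_of_le_one_of_nonpos hx hle (by norm_num)))
  · intro h
    exact ⟨Real.rpow_pos_of_pos hx _, Real.rpow_lt_one_of_one_lt_of_neg h (by norm_num)⟩

/-- The indicators let the change of variables on (0,∞) serve for (0,1), which corresponds to t > 1.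
-/
lemma kernel_substitution (s : ℝ) (m j : ℕ) {x : ℝ} (hx : x ∈ Ioi (0 : ℝ)) :
    (|(-2 : ℝ)| * x ^ ((-2 : ℝ) - 1)) •
        (Ioo (0 : ℝ) 1).indicator (fun u => u ^ j * kernel s m u) (x ^ (-2 : ℝ)) =
      (Ioi (1 : ℝ)).indicator
        (fun t => 2 * (t ^ ((2 * m - 1 - 2 * j : ℤ) - 1) * Real.exp (-s * t))) x := by
  have hx0 : 0 < x := hx
  by_cases h : x ∈ Ioi (1 : ℝ)
  · rw [indicator_of_mem ((rpow_neg_two_mem_Ioo hx0).2 h), indicator_of_mem h, kernel,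
      smul_eq_mul, ← Real.rpow_natCast, ← Real.rpow_mul hx0.le, ← Real.rpow_mul hx0.le,
      ← Real.rpow_mul hx0.le, abs_neg, abs_two, ← Real.rpow_intCast]
    rw [show (-2 : ℝ) * (-(1 / 2)) = 1 by norm_num, Real.rpow_one]
    have e : x ^ (((2 * m - 1 - 2 * j : ℤ) - 1 : ℤ) : ℝ) =
        x ^ ((-2 : ℝ) - 1) * (x ^ ((-2 : ℝ) * j) * x ^ ((-2 : ℝ) * (-(m : ℝ) - 1 / 2))) := by
      rw [← Real.rpow_add hx0, ← Real.rpow_add hx0]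
      congr 1
      push_cast
      ring
    rw [e]
    ring
  · rw [indicator_of_notMem (fun h' => h ((rpow_neg_two_mem_Ioo hx0).1 h')),
      indicator_of_notMem h, smul_zero]

lemma setIntegral_kernel (s : ℝ) (m j : ℕ) :
    ∫ u in Ioo (0 : ℝ) 1, u ^ j * kernel s m u = 2 * expInt s (2 * m - 1 - 2 * j) := by
  have h := integral_comp_rpow_Ioi
    ((Ioo (0 : ℝ) 1).indicator (fun u => u ^ j * kernel s m u)) (p := -2) (by norm_num)
  rw [setIntegral_congr_fun measurableSet_Ioi fun x hx => kernel_substitution s m j hx,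
    setIntegral_indicator measurableSet_Ioi, setIntegral_indicator measurableSet_Ioo,
    inter_eq_right.2 (Ioi_subset_Ioi zero_le_one), inter_eq_right.2 Ioo_subset_Ioi_self,
    integral_const_mul] at h
  rw [← h, expInt]

lemma integrableOn_kernel {s : ℝ} (hs : 0 < s) (m : ℕ) : IntegrableOn (kernel s m) (Ioo 0 1) := by
  have h := (integrableOn_Ioi_comp_rpow_iff
    ((Ioo (0 : ℝ) 1).indicator (fun u => u ^ 0 * kernel s m u)) (p := -2) (by norm_num)).1 ?_
  · have h2 := (integrableOn_indicator_iff measurableSet_Ioo).1 h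
    rw [inter_eq_left.2 Ioo_subset_Ioi_self] at h2
    simpa using h2
  · refine IntegrableOn.congr_fun ?_ (fun x hx => (kernel_substitution s m 0 hx).symm)
      measurableSet_Ioi
    refine (IntegrableOn.integrable_indicator ?_ measurableSet_Ioi).integrableOn
    exact (integrableOn_zpow_mul_exp hs _).const_mul 2

lemma hasSum_integral_kernel {s c : ℝ} (hs : 0 < s) (hc : 0 < c) (m : ℕ) :
    HasSum (fun j : ℕ => binCoeff c j * (2 * expInt s (2 * m - 1 - 2 * j)))
      (∫ u in Ioo (0 : ℝ) 1, (1 - u) ^ c * kernel s m u) := by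
  simpa only [setIntegral_kernel] using
    hasSum_integral_one_sub_rpow_mul hc (integrableOn_kernel hs m)

/-! ### Rearranging the double series -/

/-- The denominators are integers, so their inverses, 0 included, are at most 1 in absolute value; a
product of two convergent series dominates. -/
lemma summable_double {s c : ℝ} (hs : 0 < s) (hc : 0 < c) (m : ℕ) :
    Summable fun q : ℕ × ℕ => binCoeff c q.1 * ((-s) ^ q.2 / (q.2.factorial : ℝ) *
      ((q.2 : ℝ) + ((2 * m - 1 - 2 * q.1 : ℤ) : ℝ))⁻¹) := by
  refine Summable.of_norm_bounded ((summable_abs_binCoeff hc).mul_of_nonneg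
    (Real.summable_pow_div_factorial s) (fun j => abs_nonneg _) (fun k => by positivity))
    fun q => ?_
  rw [norm_mul, norm_mul, norm_div, norm_pow, norm_neg, Real.norm_natCast, Real.norm_of_nonneg hs.le,
    Real.norm_eq_abs, Real.norm_eq_abs]
  gcongr
  exact mul_le_of_le_one_right (by positivity) (abs_inv_nat_add_int_le_one q.2 _)

lemma tsum_binCoeff_even (c : ℝ) (m r : ℕ) :
    ∑' j : ℕ, binCoeff c j * (((2 * r : ℕ) : ℝ) + ((2 * m - 1 - 2 * j : ℤ) : ℝ))⁻¹ =
      -(1 / 2) * betaSeries c (1 / 2 - m - r) := by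
  rw [betaSeries, ← tsum_mul_left]
  refine tsum_congr fun j => ?_
  rw [show ((2 * r : ℕ) : ℝ) + ((2 * m - 1 - 2 * j : ℤ) : ℝ) = -2 * (j + (1 / 2 - m - r)) by
    push_cast; ring, mul_inv]
  ring

lemma tsum_binCoeff_odd (c : ℝ) (m r : ℕ) :
    ∑' j : ℕ, binCoeff c j * (((2 * r + 1 : ℕ) : ℝ) + ((2 * m - 1 - 2 * j : ℤ) : ℝ))⁻¹ =
      -(1 / 2) * betaSeries c (-((m + r : ℕ) : ℝ)) := by
  rw [betaSeries, ← tsum_mul_left]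
  refine tsum_congr fun j => ?_
  rw [show ((2 * r + 1 : ℕ) : ℝ) + ((2 * m - 1 - 2 * j : ℤ) : ℝ) = -2 * (j + -((m + r : ℕ) : ℝ)) by
    push_cast; ring, mul_inv]
  ring

/-- The terms of the part of the expansion with even powers of `s`. -/
def evenTerm (c s : ℝ) (m r : ℕ) : ℝ :=
  s ^ (2 * r) / ((2 * r).factorial : ℝ) * betaSeries c (1 / 2 - m - r)

/-- The terms of the part of the expansion with odd powers of `s` and logarithms. -/
def logTerm (c s : ℝ) (m r : ℕ) : ℝ :=
  -(s ^ (2 * r + 1) / ((2 * r + 1).factorial : ℝ)) *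
    (2 * binCoeff c (m + r) * (-Real.log s + psi (2 * r + 2)) + betaSeries c (-((m + r : ℕ) : ℝ)))

/-- The double sum D is computed by rows (`expSum`) and by columns (`betaSeries`). Adding 2D to the
termwise integral leaves only closed terms, and -2D supplies the even terms and the `betaSeries`
part of the odd ones. -/
lemma setIntegral_expansion {s c : ℝ} (hs : 0 < s) (hc : 0 < c) (m : ℕ) :
    Summable (logTerm c s m) ∧
    ∫ u in Ioo (0 : ℝ) 1, (1 - u) ^ c * kernel s m u =
      ∑' r, evenTerm c s m r
        + ∑ j ∈ Finset.range m, 2 * binCoeff c j *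
            (((2 * (m - 1 - j)).factorial : ℝ) / s ^ (2 * (m - 1 - j) + 1))
        + ∑' r, logTerm c s m r := by
  set J := ∫ u in Ioo (0 : ℝ) 1, (1 - u) ^ c * kernel s m u with hJ
  have hd := summable_double hs hc m
  obtain ⟨D, hD⟩ := hd
  have h1 : HasSum (fun j : ℕ => binCoeff c j * expSum s (2 * m - 1 - 2 * j)) D :=
    hD.prod_fiberwise fun j => (summable_expSum s _).hasSum.mul_left _
  have h2 : HasSum (fun k : ℕ => (-s) ^ k / (k.factorial : ℝ) *
      ∑' j : ℕ, binCoeff c j * ((k : ℝ) + ((2 * m - 1 - 2 * j : ℤ) : ℝ))⁻¹) D := by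
    have hD' := (Equiv.prodComm ℕ ℕ).hasSum_iff.2 hD
    refine hD'.prod_fiberwise fun k => ?_
    have hk := (summable_binCoeff_mul_inv hc (-((k : ℝ) / 2 + m - 1 / 2))).mul_left (-(1 / 2))
    have hk2 : Summable fun j : ℕ =>
        binCoeff c j * ((k : ℝ) + ((2 * m - 1 - 2 * j : ℤ) : ℝ))⁻¹ := by
      refine hk.congr fun j => ?_
      rw [show (k : ℝ) + ((2 * m - 1 - 2 * j : ℤ) : ℝ) = -2 * (j + -((k : ℝ) / 2 + m - 1 / 2)) by
        push_cast; ring, mul_inv]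
      ring
    refine hasSum_congr (hk2.hasSum.mul_left ((-s) ^ k / (k.factorial : ℝ))) (fun j => ?_) rfl
    simp only [Function.comp_apply, Equiv.prodComm_apply, Prod.swap_prod_mk]
    ring
  have hev : Summable (evenTerm c s m) := by
    have h := (h2.summable.comp_injective
      (i := fun r : ℕ => 2 * r) (fun a b h => by simpa using h)).mul_left (-2)
    refine h.congr fun r => ?_
    rw [Function.comp_apply, tsum_binCoeff_even, evenTerm, Even.neg_pow (even_two_mul r)]
    ring
  have hodd : Summable fun r : ℕ => s ^ (2 * r + 1) / ((2 * r + 1).factorial : ℝ) *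
      betaSeries c (-((m + r : ℕ) : ℝ)) := by
    have h := (h2.summable.comp_injective
      (i := fun r : ℕ => 2 * r + 1) (fun a b h => by simpa using h)).mul_left 2
    refine h.congr fun r => ?_
    rw [Function.comp_apply, tsum_binCoeff_odd, Odd.neg_pow (odd_two_mul_add_one r)]
    ring
  have hD2 := h2.unique (HasSum.even_add_odd
    (hasSum_congr (hev.hasSum.mul_left (-(1 / 2))) (fun r => by
      rw [tsum_binCoeff_even, evenTerm, Even.neg_pow (even_two_mul r)]; ring) rfl)
    (hasSum_congr (hodd.hasSum.mul_left (1 / 2)) (fun r => by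
      rw [tsum_binCoeff_odd, Odd.neg_pow (odd_two_mul_add_one r)]; ring) rfl))
  have h3 : HasSum (fun j : ℕ => 2 * binCoeff c j *
      (expInt s (2 * m - 1 - 2 * j) + expSum s (2 * m - 1 - 2 * j))) (J + 2 * D) :=
    hasSum_congr ((hasSum_integral_kernel hs hc m).add (h1.mul_left 2)) (fun j => by ring) rfl
  have h4 := (hasSum_nat_add_iff' m).2 h3
  -- From j = m on, the exponential integrals sit at -(2r+1) with j = r+m; this pairs the logarithms
  -- with odd powers of s.
  have h5 := hasSum_congr (h4.neg.add hodd.hasSum).neg (g := logTerm c s m) (fun r => by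
    have e : (2 * (m : ℤ) - 1 - 2 * ((r + m : ℕ) : ℤ)) = -((2 * r + 1 : ℕ) : ℤ) := by
      push_cast; ring
    have e2 : (((2 * r + 1 : ℕ) : ℝ) + 1) = 2 * r + 2 := by push_cast; ring
    rw [e, expInt_neg_natCast hs, sub_add_cancel, e2, logTerm, add_comm r m,
      Odd.neg_pow (odd_two_mul_add_one r)]
    ring) rfl
  refine ⟨h5.summable, ?_⟩
  rw [h5.tsum_eq, hD2]
  have h6 : ∑ j ∈ Finset.range m, 2 * binCoeff c j *
      (expInt s (2 * m - 1 - 2 * j) + expSum s (2 * m - 1 - 2 * j)) =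
      ∑ j ∈ Finset.range m, 2 * binCoeff c j *
            (((2 * (m - 1 - j)).factorial : ℝ) / s ^ (2 * (m - 1 - j) + 1)) := by
    refine Finset.sum_congr rfl fun j hj => ?_
    have hj' := Finset.mem_range.1 hj
    have e : (2 * (m : ℤ) - 1 - 2 * j) = ((2 * (m - 1 - j) : ℕ) : ℤ) + 1 := by omega
    rw [e, expInt_natCast_add_one hs, sub_add_cancel]
  rw [h6]
  ring

/-! ### Reduction to the unit interval -/

lemma integrand_eq {α b : ℝ} (hα : α < 1) (m : ℕ) {x : ℝ} (hx : 0 < x) :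
    integrand α b (-(m : ℝ) - 1 / 2) x = (1 - α) ^ (-(-(m : ℝ) - 1 / 2)) *
      ((1 - (1 - α) * x) ^ (1 / (1 - α)) * kernel (b * √(1 - α)) m ((1 - α) * x)) := by
  have ha : 0 < 1 - α := by linarith
  have h1 : (1 - α) ^ (-(-(m : ℝ) - 1 / 2)) * (1 - α) ^ (-(m : ℝ) - 1 / 2) = 1 := by
    rw [← Real.rpow_add ha, neg_add_cancel, Real.rpow_zero]
  have h2 : √(1 - α) * (1 - α) ^ (-(1 / 2) : ℝ) = 1 := by
    rw [Real.sqrt_eq_rpow, ← Real.rpow_add ha]; simp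
  rw [integrand, kernel, Real.mul_rpow ha.le hx.le, Real.mul_rpow ha.le hx.le]
  rw [show -(b * √(1 - α)) * ((1 - α) ^ (-(1 / 2) : ℝ) * x ^ (-(1 / 2) : ℝ)) =
    -b * x ^ (-(1 / 2) : ℝ) * (√(1 - α) * (1 - α) ^ (-(1 / 2) : ℝ)) by ring, h2, mul_one]
  linear_combination (-(x ^ (-(m : ℝ) - 1 / 2) * (1 - (1 - α) * x) ^ (1 / (1 - α)) *
    Real.exp (-b * x ^ (-(1 / 2) : ℝ)))) * h1

lemma intervalIntegrable_one_sub_rpow_mul_kernel {s c : ℝ} (hs : 0 < s) (hc : 0 < c) (m : ℕ) :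
    IntervalIntegrable (fun u => (1 - u) ^ c * kernel s m u) volume 0 1 := by
  rw [intervalIntegrable_iff_integrableOn_Ioo_of_le zero_le_one]
  refine Integrable.bdd_mul (c := 1) (integrableOn_kernel hs m) ?_ ?_
  · exact ((continuous_const.sub continuous_id).rpow_const
      fun _ => Or.inr hc.le).aestronglyMeasurable
  · refine (ae_restrict_iff' measurableSet_Ioo).2 (.of_forall fun u hu => ?_)
    have h1 : 0 ≤ 1 - u := by linarith [hu.2]
    rw [Real.norm_of_nonneg (Real.rpow_nonneg h1 _)]
    exact Real.rpow_le_one h1 (by linarith [hu.1]) hc.le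

lemma intervalIntegrable_integrand {α b : ℝ} (hα : α < 1) (hb : 0 < b) (m : ℕ) :
    IntervalIntegrable (integrand α b (-(m : ℝ) - 1 / 2)) volume 0 (1 / (1 - α)) := by
  have ha : 0 < 1 - α := by linarith
  have hs : 0 < b * √(1 - α) := by positivity
  have h := ((intervalIntegrable_one_sub_rpow_mul_kernel hs (one_div_pos.2 ha) m).comp_mul_left
    (c := 1 - α)).const_mul ((1 - α) ^ (-(-(m : ℝ) - 1 / 2)))
  rw [zero_div] at h
  refine h.congr fun x hx => ?_
  rw [uIoc_of_le (one_div_pos.2 ha).le] at hx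
  exact (integrand_eq hα m hx.1).symm

lemma I2_eq {α b : ℝ} (hα : α < 1) (m : ℕ) :
    I2 α b (-(m : ℝ) - 1 / 2) = 1 / (1 - α) ^ (-(m : ℝ) - 1 / 2 + 1) *
      ∫ u in Ioo (0 : ℝ) 1, (1 - u) ^ (1 / (1 - α)) * kernel (b * √(1 - α)) m u := by
  have ha : 0 < 1 - α := by linarith
  have h := intervalIntegral.integral_comp_mul_left (a := 0) (b := 1 / (1 - α))
    (fun u => (1 - u) ^ (1 / (1 - α)) * kernel (b * √(1 - α)) m u) ha.ne'
  rw [mul_zero, mul_one_div_cancel ha.ne', intervalIntegral.integral_of_le zero_le_one,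
    integral_Ioc_eq_integral_Ioo] at h
  have e : I2 α b (-(m : ℝ) - 1 / 2) = ∫ x in (0 : ℝ)..(1 / (1 - α)),
      (1 - α) ^ (-(-(m : ℝ) - 1 / 2)) *
      ((1 - (1 - α) * x) ^ (1 / (1 - α)) * kernel (b * √(1 - α)) m ((1 - α) * x)) := by
    rw [I2, intervalIntegral.integral_of_le (one_div_pos.2 ha).le,
      intervalIntegral.integral_of_le (one_div_pos.2 ha).le]
    exact setIntegral_congr_fun measurableSet_Ioc fun x hx => integrand_eq hα m hx.1
  rw [e, intervalIntegral.integral_const_mul, h, smul_eq_mul, ← mul_assoc, Real.rpow_add_one ha.ne',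
    Real.rpow_neg ha.le, one_div (_ * _), mul_inv]

/-! ### Identifying the hypergeometric and finite parts -/

lemma inv_rGamma (x : ℝ) : (rGamma x)⁻¹ = Real.Gamma x := inv_inv _

lemma rGamma_sub_nat (w : ℝ) (r : ℕ) :
    rGamma (w - r) = (-1) ^ r * poch (1 - w) r * rGamma w := by
  induction r with
  | zero => simp [poch_zero]
  | succ r ih =>
    rw [rGamma_eq, show w - ((r + 1 : ℕ) : ℝ) + 1 = w - r by push_cast; ring, ih, poch_succ]
    push_cast
    ring

/-- Inverting `rGamma_sub_nat` gives this for every w, since the inverse of 0 is 0. -/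
lemma Gamma_div_poch (w : ℝ) (r : ℕ) :
    Real.Gamma w / poch (1 - w) r = (-1) ^ r * Real.Gamma (w - r) := by
  rw [← inv_rGamma (w - r), rGamma_sub_nat, mul_inv, mul_inv, inv_rGamma, ← mul_assoc, ← mul_assoc,
    ← inv_pow, ← mul_pow, div_eq_mul_inv]
  norm_num
  ring

lemma poch_pos {a : ℝ} (ha : 0 < a) (r : ℕ) : 0 < poch a r := by
  induction r with
  | zero => simp [poch_zero]
  | succ r ih => rw [poch_succ]; positivity

lemma two_mul_factorial (r : ℕ) :
    ((2 * r).factorial : ℝ) = 4 ^ r * (r.factorial : ℝ) * poch (1 / 2) r := by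
  induction r with
  | zero => simp [poch_zero]
  | succ r ih =>
    rw [show 2 * (r + 1) = 2 * r + 1 + 1 by ring, Nat.factorial_succ, Nat.factorial_succ,
      Nat.factorial_succ, poch_succ]
    push_cast
    rw [ih]
    ring

lemma two_mul_add_one_factorial (r : ℕ) :
    ((2 * r + 1).factorial : ℝ) = 4 ^ r * (r.factorial : ℝ) * poch (3 / 2) r := by
  induction r with
  | zero => simp [poch_zero]
  | succ r ih =>
    rw [show 2 * (r + 1) + 1 = 2 * r + 1 + 1 + 1 by ring, Nat.factorial_succ (2 * r + 1 + 1),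
      Nat.factorial_succ (2 * r + 1), Nat.factorial_succ r, poch_succ]
    push_cast
    rw [ih]
    ring

lemma summable_hyp1F2Term (a z : ℝ) {b₁ b₂ : ℝ} (h₁ : 0 < b₁) (h₂ : 0 < b₂) :
    Summable (hyp1F2Term a b₁ b₂ z) := by
  have hstep : ∀ r, hyp1F2Term a b₁ b₂ z (r + 1) =
      ((a + r) / (b₁ + r) * (z / (b₂ + r)) / (r + 1)) * hyp1F2Term a b₁ b₂ z r := by
    intro r
    have p1 := (poch_pos h₁ r).ne'
    have p2 := (poch_pos h₂ r).ne'
    have q1 : b₁ + r ≠ 0 := by positivity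
    have q2 : b₂ + r ≠ 0 := by positivity
    have q3 : (r : ℝ) + 1 ≠ 0 := by positivity
    have hf : ((r.factorial : ℕ) : ℝ) ≠ 0 := by positivity
    rw [hyp1F2Term, hyp1F2Term, poch_succ, poch_succ, poch_succ, Nat.factorial_succ]
    push_cast
    field_simp
    ring
  have hn : Tendsto (fun r : ℕ => (r : ℝ)) atTop atTop := tendsto_natCast_atTop_atTop
  have t1 : Tendsto (fun r : ℕ => (a + r) / (b₁ + r)) atTop (𝓝 1) := by
    have h := (tendsto_const_nhds (x := a - b₁)).div_atTop (tendsto_atTop_add_const_left _ b₁ hn)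
    refine ((h.const_add 1).congr fun r => ?_).trans (by simp)
    have q1 : b₁ + r ≠ 0 := by positivity
    field_simp
    ring
  have t2 : Tendsto (fun r : ℕ => z / (b₂ + r)) atTop (𝓝 0) :=
    tendsto_const_nhds.div_atTop (tendsto_atTop_add_const_left _ b₂ hn)
  have t3 := ((t1.mul t2).div_atTop (tendsto_atTop_add_const_right _ 1 hn)).norm
  rw [norm_zero] at t3
  refine summable_of_ratio_norm_eventually_le (r := 1 / 2) (by norm_num) ?_
  filter_upwards [t3.eventually (ge_mem_nhds (by norm_num : (0 : ℝ) < 1 / 2))] with r hr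
  rw [hstep, norm_mul]
  gcongr

lemma evenTerm_eq {c s : ℝ} (hc : 0 < c) (m r : ℕ) :
    evenTerm c s m r = Real.Gamma (c + 1) * Real.Gamma (1 / 2 - m) / Real.Gamma (3 / 2 - m + c) *
      hyp1F2Term (m - 1 / 2 - c) (1 / 2) (1 / 2 + m) (s ^ 2 / 4) r := by
  have hx : ∀ n : ℕ, (1 / 2 : ℝ) - m - r ≠ -n := fun n h =>
    half_sub_ne_neg_nat (m + r) n (by push_cast; linarith)
  have h1 := Gamma_div_poch (1 / 2 - m) r
  rw [show 1 - (1 / 2 - (m : ℝ)) = 1 / 2 + m by ring] at h1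
  have h2 := rGamma_sub_nat (3 / 2 - m + c) r
  rw [show 1 - (3 / 2 - (m : ℝ) + c) = m - 1 / 2 - c by ring] at h2
  have h3 : Real.Gamma (1 / 2 - m - r) = (-1) ^ r * (Real.Gamma (1 / 2 - m) / poch (1 / 2 + m) r) := by
    rw [h1, ← mul_assoc, ← mul_pow]; norm_num
  have hsq : ((-1 : ℝ) ^ r) * (-1) ^ r = 1 := by rw [← mul_pow]; norm_num
  rw [evenTerm, betaSeries_eq hc hx,
    show (1 / 2 : ℝ) - m - r + (c + 1) = 3 / 2 - m + c - r by ring, h2, h3, hyp1F2Term,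
    two_mul_factorial, rGamma, pow_mul, div_pow]
  linear_combination ((s ^ 2) ^ r / (4 ^ r * (r.factorial : ℝ) * poch (1 / 2) r) *
    (Real.Gamma (1 / 2 - m) / poch (1 / 2 + m) r * Real.Gamma (c + 1) *
      poch (m - 1 / 2 - c) r * (Real.Gamma (3 / 2 - m + c))⁻¹)) * hsq

/-- With l = m-1-j, duplication writes (2l)! through Γ(l+1/2)Γ(l+1); `Gamma_div_poch` shifts both
arguments up by j, its two signs cancelling. -/
lemma finite_term_eq {c s : ℝ} (hs : 0 < s) (hc : 0 < c) {m j : ℕ} (hj : j < m) :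
    2 * binCoeff c j * (((2 * (m - 1 - j)).factorial : ℝ) / s ^ (2 * (m - 1 - j) + 1)) =
      Real.Gamma (c + 1) / √Real.pi * (Real.Gamma (m - 1 / 2) * Real.Gamma m / Real.Gamma (1 + c) *
        (s ^ 2 / 4) ^ (1 / 2 - (m : ℝ)) *
        (1 / (j.factorial : ℝ) * (poch (-c) j / (poch (3 / 2 - m) j * poch (1 - m) j)) *
          (s ^ 2 / 4) ^ j)) := by
  obtain ⟨l, rfl⟩ : ∃ l, m = l + 1 + j := ⟨m - 1 - j, by omega⟩
  rw [show l + 1 + j - 1 - j = l by omega]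
  have hz : (0 : ℝ) < s ^ 2 / 4 := by positivity
  have h1 := Gamma_div_poch (((l + 1 + j : ℕ) : ℝ) - 1 / 2) j
  have h2 := Gamma_div_poch (((l + 1 + j : ℕ) : ℝ)) j
  rw [show 1 - (((l + 1 + j : ℕ) : ℝ) - 1 / 2) = 3 / 2 - ((l + 1 + j : ℕ) : ℝ) by ring,
    show ((l + 1 + j : ℕ) : ℝ) - 1 / 2 - j = l + 1 / 2 by push_cast; ring] at h1
  rw [show ((l + 1 + j : ℕ) : ℝ) - j = l + 1 / 2 + 1 / 2 by push_cast; ring] at h2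
  have h3 := Real.Gamma_mul_Gamma_add_half ((l : ℝ) + 1 / 2)
  rw [show 2 * ((l : ℝ) + 1 / 2) = ((2 * l : ℕ) : ℝ) + 1 by push_cast; ring,
    Real.Gamma_nat_eq_factorial, show 1 - (((2 * l : ℕ) : ℝ) + 1) = -((2 * l : ℕ) : ℝ) by ring,
    Real.rpow_neg zero_le_two, Real.rpow_natCast] at h3
  have h4 : (s ^ 2 / 4) ^ (1 / 2 - ((l + 1 + j : ℕ) : ℝ)) * (s ^ 2 / 4) ^ j =
      ((s / 2) ^ (2 * l + 1))⁻¹ := by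
    rw [← Real.rpow_natCast _ j, ← Real.rpow_add hz, show s ^ 2 / 4 = (s / 2) ^ (2 : ℝ) by
      rw [Real.rpow_two]; ring, ← Real.rpow_mul (by positivity), ← Real.rpow_natCast,
      ← Real.rpow_neg (by positivity)]
    congr 1
    push_cast
    ring
  have hsq : ((-1 : ℝ) ^ j) * (-1) ^ j = 1 := by rw [← mul_pow]; norm_num
  have hG : Real.Gamma (c + 1) ≠ 0 := (Real.Gamma_pos_of_pos (by linarith)).ne'
  have hpi : √Real.pi ≠ 0 := by positivity
  have hf : ((j.factorial : ℕ) : ℝ) ≠ 0 := by positivity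
  set z := s ^ 2 / 4 with hzdef
  set M : ℝ := ((l + 1 + j : ℕ) : ℝ) with hM
  calc 2 * binCoeff c j * (((2 * l).factorial : ℝ) / s ^ (2 * l + 1))
      = binCoeff c j / √Real.pi * ((((2 * l).factorial : ℝ) * (2 ^ (2 * l))⁻¹ * √Real.pi) *
          ((s / 2) ^ (2 * l + 1))⁻¹) := by
        rw [div_pow]
        have hs0 := hs.ne'
        field_simp
        ring
    _ = binCoeff c j / √Real.pi * (((Real.Gamma (M - 1 / 2) / poch (3 / 2 - M) j) *
          (Real.Gamma M / poch (1 - M) j)) * (z ^ (1 / 2 - M) * z ^ j)) := by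
        rw [← h3, ← h4, h1, h2]
        linear_combination (-(binCoeff c j / √Real.pi * (Real.Gamma (l + 1 / 2) *
          Real.Gamma (l + 1 / 2 + 1 / 2)) * (z ^ (1 / 2 - M) * z ^ j))) * hsq
    _ = _ := by
        rw [binCoeff, add_comm 1 c]
        field_simp

/-! ### Logarithmic coefficients and their limits -/

/-- The coefficient `[-ln z + G'_r] H'_r` written with `1/Γ` and its derivative. -/
def regCoeff (m : ℕ) (b : ℝ) (r : ℕ) (α : ℝ) : ℝ :=
  (-1) ^ (m + r) / (poch (3 / 2) r * (r.factorial : ℝ) * ((m + r).factorial : ℝ)) *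
    ((-Real.log (zArg α b) + psi (-(1 / 2) - r) + psi (1 + r) + psi (1 + m + r)) *
      rGamma (1 + 1 / (1 - α) - m - r) + deriv rGamma (1 + 1 / (1 - α) - m - r))

lemma coeffH_eq (m : ℕ) (α : ℝ) (r : ℕ) : coeffH m α r =
    (-1) ^ (m + r) / (poch (3 / 2) r * (r.factorial : ℝ) * ((m + r).factorial : ℝ)) *
      rGamma (1 + 1 / (1 - α) - m - r) := by
  have h := rGamma_sub_nat (1 + 1 / (1 - α) - m) r
  rw [show 1 - (1 + 1 / (1 - α) - (m : ℝ)) = m - 1 / (1 - α) by ring] at h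
  have hsq : ((-1 : ℝ) ^ r) * (-1) ^ r = 1 := by rw [← mul_pow]; norm_num
  rw [h, coeffH, rGamma, pow_add, ← div_div, div_eq_mul_inv _ (Real.Gamma _)]
  linear_combination (-((-1) ^ m * poch (m - 1 / (1 - α)) r /
    (poch (3 / 2) r * (r.factorial : ℝ) * ((m + r).factorial : ℝ)) *
      (Real.Gamma (1 + 1 / (1 - α) - m))⁻¹)) * hsq

lemma rawLogCoeff_eq_regCoeff (m : ℕ) (b : ℝ) (r : ℕ) {α : ℝ}
    (h : ∀ n : ℕ, 1 + 1 / (1 - α) - m - r ≠ -n) : rawLogCoeff m b r α = regCoeff m b r α := by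
  rw [rawLogCoeff, regCoeff, coeffH_eq, deriv_rGamma h, coeffG]
  ring

/-- At a pole 1/Γ vanishes and only its derivative (-1)^n n! at -n survives, where n = m+r-1-N. -/
lemma logCoeff_eq_regCoeff (m : ℕ) (b : ℝ) (r : ℕ) {α : ℝ} (hα : α < 1) :
    logCoeff m b r α = regCoeff m b r α := by
  have hc : 0 < 1 / (1 - α) := one_div_pos.2 (by linarith)
  rw [logCoeff]
  split_ifs with h
  · obtain ⟨n, hn⟩ := h
    have hlt : n < m + r := by
      have : (n : ℝ) + 1 < m + r + 1 := by linarith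
      exact_mod_cast (by linarith : (n : ℝ) < m + r)
    obtain ⟨N, hN⟩ : ∃ N, m + r = N + 1 + n := ⟨m + r - 1 - n, by omega⟩
    have hN' : (m : ℝ) + r = N + 1 + n := by exact_mod_cast hN
    have hcN : 1 / (1 - α) = N := by linarith
    have hsq : ((-1 : ℝ) ^ n) * (-1) ^ n = 1 := by rw [← mul_pow]; norm_num
    rw [regCoeff, hn, rGamma_neg_nat, deriv_rGamma_neg_nat, hcN, Nat.floor_natCast,
      show m + r - 1 - N = n by omega, mul_zero, zero_add]
    rw [hN, pow_add _ (N + 1) n]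
    linear_combination (-((-1) ^ (N + 1) * (n.factorial : ℝ) / (poch (3 / 2) r * (r.factorial : ℝ) *
      ((N + 1 + n).factorial : ℝ)))) * hsq
  · exact rawLogCoeff_eq_regCoeff m b r (not_exists.1 h)

lemma continuous_deriv_rGamma : Continuous (deriv rGamma) := by
  have hc : ContDiff ℂ 1 fun s : ℂ => (Complex.Gamma s)⁻¹ :=
    Complex.differentiable_one_div_Gamma.contDiff
  have he : rGamma = fun y : ℝ => ((Complex.Gamma y)⁻¹).re := funext fun y => by
    rw [Complex.Gamma_ofReal, ← Complex.ofReal_inv, Complex.ofReal_re, rGamma]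
  have hd : deriv rGamma = fun x : ℝ => (deriv (fun s : ℂ => (Complex.Gamma s)⁻¹) x).re := by
    funext x
    rw [he]
    exact (Complex.differentiable_one_div_Gamma x).hasDerivAt.real_of_complex.deriv
  rw [hd]
  exact Complex.continuous_re.comp ((hc.continuous_deriv le_rfl).comp Complex.continuous_ofReal)

/-- The integers other than w form a closed set avoiding w. -/
lemma eventually_ne_neg_nat (w : ℝ) : ∀ᶠ x : ℝ in 𝓝[≠] w, ∀ n : ℕ, x ≠ -n := by
  have hS : IsClosed ((fun k : ℤ => (k : ℝ)) '' {k : ℤ | (k : ℝ) ≠ w}) :=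
    Int.isClosedEmbedding_coe_real.isClosedMap _ (isClosed_discrete _)
  have hw : w ∈ ((fun k : ℤ => (k : ℝ)) '' {k : ℤ | (k : ℝ) ≠ w})ᶜ := by
    rintro ⟨k, hk, hkw⟩
    exact hk hkw
  filter_upwards [nhdsWithin_le_nhds (hS.isOpen_compl.mem_nhds hw), self_mem_nhdsWithin]
    with x hx hxw n hn
  refine hx ⟨-(n : ℤ), ?_, by simp [hn]⟩
  have : x ≠ w := hxw
  rw [hn] at this
  simpa using this

lemma tendsto_rawLogCoeff (m : ℕ) {α b : ℝ} (hα : α < 1) (hb : 0 < b) (r : ℕ) :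
    Tendsto (rawLogCoeff m b r) (𝓝[≠] α) (𝓝 (logCoeff m b r α)) := by
  have ha : 1 - α ≠ 0 := by linarith
  have hw : ContinuousAt (fun β : ℝ => 1 + 1 / (1 - β) - m - r) α := by
    fun_prop (disch := exact ha)
  have hz : ContinuousAt (fun β : ℝ => Real.log (zArg β b)) α := by
    refine ContinuousAt.log (by unfold zArg; fun_prop) ?_
    rw [zArg]
    have : 0 < 1 - α := by linarith
    positivity
  have hQ : ContinuousAt (regCoeff m b r) α := by
    unfold regCoeff
    refine continuousAt_const.mul (ContinuousAt.add (ContinuousAt.mul ?_ ?_) ?_)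
    · exact ((hz.neg.add continuousAt_const).add continuousAt_const).add continuousAt_const
    · exact ContinuousAt.comp' (differentiable_rGamma.continuous.continuousAt) hw
    · exact ContinuousAt.comp' continuous_deriv_rGamma.continuousAt hw
  rw [logCoeff_eq_regCoeff m b r hα]
  refine (hQ.tendsto.mono_left nhdsWithin_le_nhds).congr' ?_
  -- As β ↦ 1/(1-β) is injective, β ≠ α keeps the gamma argument off its limit, hence eventually off
  -- every pole.
  have ht : Tendsto (fun β : ℝ => 1 + 1 / (1 - β) - m - r) (𝓝[≠] α)
      (𝓝[≠] (1 + 1 / (1 - α) - m - r)) := by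
    refine tendsto_nhdsWithin_iff.2 ⟨hw.tendsto.mono_left nhdsWithin_le_nhds, ?_⟩
    filter_upwards [self_mem_nhdsWithin] with β hβ h
    have h1 : 1 / (1 - β) = 1 / (1 - α) := by
      have h' : 1 + 1 / (1 - β) - m - r = 1 + 1 / (1 - α) - m - r := h
      linarith
    rw [one_div, one_div, inv_inj] at h1
    exact hβ (show β = α by linarith)
  filter_upwards [ht.eventually (eventually_ne_neg_nat _)] with β hβ
  exact (rawLogCoeff_eq_regCoeff m b r hβ).symm

/-! ### Assembling the expansion -/

lemma zArg_eq {α b : ℝ} (hα : α < 1) : zArg α b = (b * √(1 - α)) ^ 2 / 4 := by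
  rw [zArg, mul_pow, Real.sq_sqrt (by linarith)]
  ring

/-- Here -2 ln s = -ln z - 2 ln 2, and `two_mul_psi` cancels the 2 ln 2; the remaining ψ(1+m+r) and
the derivative of 1/Γ come from `betaSeries_neg_nat`. -/
lemma logTerm_eq {α b : ℝ} (hα : α < 1) (hb : 0 < b) (m r : ℕ) :
    logTerm (1 / (1 - α)) (b * √(1 - α)) m r =
      -2 * Real.Gamma (1 / (1 - α) + 1) *
        (zArg α b ^ (1 / 2 + (r : ℝ)) * logCoeff m b r α) := by
  have hc : 0 < 1 / (1 - α) := one_div_pos.2 (by linarith)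
  have hs : 0 < b * √(1 - α) := by
    have : 0 < 1 - α := by linarith
    positivity
  have hlog : Real.log (zArg α b) = 2 * Real.log (b * √(1 - α)) - 2 * Real.log 2 := by
    rw [zArg_eq hα, Real.log_div (by positivity) (by norm_num), Real.log_pow,
      show (4 : ℝ) = 2 ^ 2 by norm_num, Real.log_pow]
    push_cast
    ring
  have hpow : zArg α b ^ (1 / 2 + (r : ℝ)) = (b * √(1 - α)) ^ (2 * r + 1) / (2 * 4 ^ r) := by
    rw [zArg_eq hα, show (b * √(1 - α)) ^ 2 / 4 = (b * √(1 - α) / 2) ^ (2 : ℝ) by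
      rw [Real.rpow_two]; ring, ← Real.rpow_mul (by positivity),
      show (2 : ℝ) * (1 / 2 + r) = ((2 * r + 1 : ℕ) : ℝ) by push_cast; ring, Real.rpow_natCast,
      div_pow, pow_succ 2, pow_mul 2]
    norm_num
    ring
  rw [logCoeff_eq_regCoeff m b r hα, regCoeff, logTerm, hpow, hlog, binCoeff_eq hc,
    betaSeries_neg_nat hc, two_mul_add_one_factorial]
  generalize b * √(1 - α) = s at *
  generalize 1 / (1 - α) = c at *
  rw [show 1 + c - (m : ℝ) - r = c + 1 - ((m + r : ℕ) : ℝ) by push_cast; ring,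
    show 1 + (m : ℝ) + r = ((m + r : ℕ) : ℝ) + 1 by push_cast; ring]
  have h2 := two_mul_psi r
  have p1 := (poch_pos (by norm_num : (0 : ℝ) < 3 / 2) r).ne'
  have hf : ((r.factorial : ℕ) : ℝ) ≠ 0 := by positivity
  have hf2 : (((m + r).factorial : ℕ) : ℝ) ≠ 0 := by positivity
  have h3 : psi (2 * r + 2) = (2 * Real.log 2 + psi (1 + r) + psi (-(1 / 2) - r)) / 2 := by linarith
  rw [h3]
  field_simp
  ring

lemma summable_log_series (m : ℕ) {α b : ℝ} (hα : α < 1) (hb : 0 < b) :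
    Summable fun r : ℕ => zArg α b ^ (1 / 2 + (r : ℝ)) * logCoeff m b r α := by
  have ha : 0 < 1 - α := by linarith
  have hc : 0 < 1 / (1 - α) := one_div_pos.2 ha
  have h := (setIntegral_expansion (s := b * √(1 - α)) (by positivity) hc m).1
  have hG : -2 * Real.Gamma (1 / (1 - α) + 1) ≠ 0 :=
    mul_ne_zero (by norm_num) (Real.Gamma_pos_of_pos (by linarith)).ne'
  exact (summable_mul_left_iff hG).1 (h.congr fun r => logTerm_eq hα hb m r)

/-- For m = 0 the middle sum is empty, so the default value of Γ(0) has no effect. -/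
lemma I2_expansion (m : ℕ) {α b : ℝ} (hα : α < 1) (hb : 0 < b) :
    I2 α b (-(m : ℝ) - 1 / 2) =
      Real.Gamma (1 / (1 - α) + 1) / (√Real.pi * (1 - α) ^ (-(m : ℝ) - 1 / 2 + 1)) *
        (√Real.pi * Real.Gamma (1 / 2 - m) / Real.Gamma (3 / 2 - m + 1 / (1 - α)) *
            hyp1F2 (m - 1 / 2 - 1 / (1 - α)) (1 / 2) (1 / 2 + m) (zArg α b)
          + Real.Gamma (m - 1 / 2) * Real.Gamma m / Real.Gamma (1 + 1 / (1 - α)) *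
            zArg α b ^ (1 / 2 - (m : ℝ)) *
            ∑ r ∈ Finset.range m,
              1 / (r.factorial : ℝ) * (poch (-(1 / (1 - α))) r /
                (poch (3 / 2 - m) r * poch (1 - m) r)) * zArg α b ^ r
          - 2 * √Real.pi * ∑' r : ℕ, zArg α b ^ (1 / 2 + (r : ℝ)) * logCoeff m b r α) := by
  have ha : 0 < 1 - α := by linarith
  have hc : 0 < 1 / (1 - α) := one_div_pos.2 ha
  have hs : 0 < b * √(1 - α) := by positivity
  have hpi : √Real.pi ≠ 0 := by positivity
  rw [I2_eq hα m, (setIntegral_expansion hs hc m).2]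
  simp only [logTerm_eq hα hb, evenTerm_eq hc]
  rw [tsum_mul_left, tsum_mul_left,
    Finset.sum_congr rfl fun j hj => finite_term_eq hs hc (Finset.mem_range.1 hj),
    ← Finset.mul_sum, ← Finset.mul_sum, ← zArg_eq hα]
  rw [hyp1F2]
  field_simp
  ring

end ThermoCutoff

end

theorem mainTheorem10 (m : ℕ) (α b ν : ℝ) (hν : ν = -(m : ℝ) - 1 / 2) (hα : α < 1) (hb : 0 < b) :
    -- the integral and the two infinite series converge
    IntervalIntegrable (ThermoCutoff.integrand α b ν) MeasureTheory.volume 0 (1 / (1 - α)) ∧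
    Summable (ThermoCutoff.hyp1F2Term (m - 1 / 2 - 1 / (1 - α)) (1 / 2) (1 / 2 + m)
      (ThermoCutoff.zArg α b)) ∧
    Summable (fun r : ℕ => ThermoCutoff.zArg α b ^ (1 / 2 + (r : ℝ)) *
      ThermoCutoff.logCoeff m b r α) ∧
    -- the logarithmic coefficients are the limits of `[-ln z + G'_r] H'_r` in the parameter
    (∀ r : ℕ, Tendsto (ThermoCutoff.rawLogCoeff m b r) (𝓝[≠] α)
      (𝓝 (ThermoCutoff.logCoeff m b r α))) ∧
    -- the series representation
    ThermoCutoff.I2 α b ν =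
      Real.Gamma (1 / (1 - α) + 1) / (Real.sqrt Real.pi * (1 - α) ^ (ν + 1)) *
        (Real.sqrt Real.pi * Real.Gamma (1 / 2 - m) / Real.Gamma (3 / 2 - m + 1 / (1 - α)) *
            ThermoCutoff.hyp1F2 (m - 1 / 2 - 1 / (1 - α)) (1 / 2) (1 / 2 + m)
              (ThermoCutoff.zArg α b)
          + Real.Gamma (m - 1 / 2) * Real.Gamma m / Real.Gamma (1 + 1 / (1 - α)) *
            ThermoCutoff.zArg α b ^ (1 / 2 - (m : ℝ)) *
            ∑ r ∈ Finset.range m,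
              1 / (r.factorial : ℝ) * (ThermoCutoff.poch (-(1 / (1 - α))) r /
                (ThermoCutoff.poch (3 / 2 - m) r * ThermoCutoff.poch (1 - m) r)) *
                ThermoCutoff.zArg α b ^ r
          - 2 * Real.sqrt Real.pi * ∑' r : ℕ, ThermoCutoff.zArg α b ^ (1 / 2 + (r : ℝ)) *
              ThermoCutoff.logCoeff m b r α) := by
  subst hν
  exact ⟨ThermoCutoff.intervalIntegrable_integrand hα hb m,
    ThermoCutoff.summable_hyp1F2Term _ _ (by norm_num) (by positivity),
    ThermoCutoff.summable_log_series m hα hb,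
    fun r => ThermoCutoff.tendsto_rawLogCoeff m hα hb r,
    ThermoCutoff.I2_expansion m hα hb⟩
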